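/- Let $d\in\mathbb N$, $d\ge 1$, let $0<p,q,\theta\le\infty$ and $\alpha>1/p$ (with $1/\infty=0$), let $\ell$ be an integer with $\ell>\alpha$, and let $\mathbb G^d$ be either the cube $\mathbb I^d=[0,1]^d$ or the torus $\mathbb T^d$ (functions on $\mathbb T^d$ are functions on $\mathbb R^d$ that are $1$-periodic in each variable). All functions are complex-valued, $\|\cdot\|_p$ is the $L_p$ quasi-norm over $[0,1]^d$ (essential supremum for $p=\infty$), $a_+=\max\{a,0\}$ and $\log^{d-1}n=(\log n)^{d-1}$. For $e\subset\{1,\dots,d\}$ and $h\in\mathbb R^d$ let $\Delta_h^{\ell,e}$ be the composition over $i\in e$ of the $\ell$-th differences $\sum_{j=0}^{\ell}(-1)^{\ell-j}\binom{\ell}{j}f(x+jh_i\mathbf e_i)$ in the variable $x_i$, where $\mathbf e_i$ is the $i$-th unit vector; on $\mathbb I^d$ the difference in $x_i$ is set to $0$ when $x_i+\ell h_i\notin[0,1]$. Put $\omega_\ell^e(f,t)_p=\sup_{|h_i|<t_i,\,i\in e}\|\Delta_h^{\ell,e}f\|_p$ and $$|f|_{e}=\Big(\int_{[0,1]^d}\Big[\prod_{i\in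 e}t_i^{-\alpha}\,\omega_\ell^e(f,t)_p\Big]^\theta\prod_{i\in e}t_i^{-1}\,dt\Big)^{1/\theta}\ (\theta<\infty),\qquad |f|_{e}=\sup_{t\in(0,1]^d}\prod_{i\in e}t_i^{-\alpha}\,\omega_\ell^e(f,t)_p\ (\theta=\infty).$$ Let $U^\alpha_{p,\theta}(\mathbb G^d)$ be the set of all continuous functions $f$ on $\mathbb G^d$ with $\|f\|_{B^\alpha_{p,\theta}(\mathbb G^d)}:=\sum_{e\subset\{1,\dots,d\}}|f|_e\le 1$, i.e. the unit ball of the Besov space of mixed smoothness, whose elements are identified with their continuous representatives. For an integer $m\ge 0$ let $G^d(m)=\bigcup_{k_1+\dots+k_d\le m}I_{k_1}\times\dots\times I_{k_d}$ (union over $k\in\mathbb Z_{\ge0}^d$), $I_k=\{2^{-k}l:\ l=0,\dots,2^k-1\}$, be the Smolyak grid, and for a class $F$ of functions let $$r^s_n(F)_q=\inf_{|G^d(m)|\le n,\ \Phi}\ \sup_{f\in F}\Big\|f-\sum_{\xi\in G^d(m)}f(\xi)\varphi_\xi\Big\|_q ,$$ the infimum being over all $m$ with $|G^d(m)|\le n$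 and all families $\Phi=(\varphi_\xi)_{\xi\in G^d(m)}$ of measurable functions. Then there is a constant $c>0$ independent of $n$ such that for all $n\in\mathbb N$, $n\ge1$: if $p\ge q$, $$r^s_n(U^\alpha_{p,\theta}(\mathbb G^d))_q\ \ge\ c\,(n^{-1}\log^{d-1}n)^{\alpha}(\log^{d-1}n)^{(1-1/\theta)_+},$$ and if $p<q$, $$r^s_n(U^\alpha_{p,\theta}(\mathbb G^d))_q\ \ge\ c\,(n^{-1}\log^{d-1}n)^{\alpha-1/p+1/q}(\log^{d-1}n)^{(1/q-1/\theta)_+}.$$ (For $d=1$, $\log^{d-1}n$ and its powers are $1$.) -/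

import Mathlib

open MeasureTheory
open scoped ENNReal

noncomputable section

namespace SmolyakSampling

/-- The two underlying domains `𝔾^d`: the unit cube `[0,1]^d` and the torus `𝕋^d`. -/
inductive Domain : Type
  | cube
  | torus

/-- The set `[0,1]^d`; it is also the period cell that represents the torus. -/
def unitCube (d : ℕ) : Set (Fin d → ℝ) :=
  Set.univ.pi fun _ => Set.Icc (0 : ℝ) 1

/-- The `L_p` quasi-norm over `[0,1]^d`, `0 < p ≤ ∞`, with values in `[0,∞]`. -/
def lpQuasiNorm {d : ℕ} (f : (Fin d → ℝ) → ℂ) (p : ℝ≥0∞) : ℝ≥0∞ :=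
  eLpNorm f p (volume.restrict (unitCube d))

/-- Continuous functions on the domain. A function on the cube is represented by a function on `ℝ^d`
whose values outside `[0,1]^d` are irrelevant; a function on the torus is a function on `ℝ^d` which
is `1`-periodic in each variable. -/
def IsContinuousOn {d : ℕ} (G : Domain) (f : (Fin d → ℝ) → ℂ) : Prop :=
  match G with
  | .cube => ContinuousOn f (unitCube d)
  | .torus => Continuous f ∧ ∀ i : Fin d, Function.Periodic f (Pi.single i 1)

/-- The sum `∑_{j=0}^ℓ (-1)^{ℓ-j} (ℓ choose j) f(x + j t e_i)`. -/
def diffSum {d : ℕ} (ℓ : ℕ) (i : Fin d) (t : ℝ) (f : (Fin d → ℝ) → ℂ) (x : Fin d → ℝ) : ℂ :=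
  ∑ j ∈ Finset.range (ℓ + 1),
    (-1 : ℂ) ^ (ℓ - j) * (ℓ.choose j : ℂ) * f (Function.update x i (x i + j * t))

/-- The `ℓ`-th difference operator with step `t` in the `i`-th variable. On the cube it is set to zero
where the step leaves `[0,1]`; on the torus the arguments are taken modulo one. -/
def diff {d : ℕ} (G : Domain) (ℓ : ℕ) (i : Fin d) (t : ℝ) (f : (Fin d → ℝ) → ℂ) :
    (Fin d → ℝ) → ℂ :=
  match G with
  | .cube => fun x => if x i + ℓ * t ∈ Set.Icc (0 : ℝ) 1 then diffSum ℓ i t f x else 0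
  | .torus => diffSum ℓ i t f

/-- The mixed difference operator: the composition of the operators `diff G ℓ i (h i)`, `i ∈ e`
(they commute); it is the identity for `e = ∅`. -/
def mixedDiff {d : ℕ} (G : Domain) (ℓ : ℕ) (e : Finset (Fin d)) (h : Fin d → ℝ)
    (f : (Fin d → ℝ) → ℂ) : (Fin d → ℝ) → ℂ :=
  (List.finRange d).foldr (fun i g => if i ∈ e then diff G ℓ i (h i) g else g) f

/-- The mixed modulus of smoothness
`ω_ℓ^e(f,t)_p = sup {‖Δ_h^{ℓ,e} f‖_p : |h_i| < t_i for i ∈ e}`. -/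
def modulus {d : ℕ} (G : Domain) (ℓ : ℕ) (e : Finset (Fin d)) (f : (Fin d → ℝ) → ℂ)
    (t : Fin d → ℝ) (p : ℝ≥0∞) : ℝ≥0∞ :=
  ⨆ (h : Fin d → ℝ) (_ : ∀ i ∈ e, |h i| < t i), lpQuasiNorm (mixedDiff G ℓ e h f) p

/-- The weighted modulus `∏_{i ∈ e} t_i^{-α} ω_ℓ^e(f,t)_p`. -/
def weightedModulus {d : ℕ} (G : Domain) (ℓ : ℕ) (α : ℝ) (e : Finset (Fin d))
    (f : (Fin d → ℝ) → ℂ) (t : Fin d → ℝ) (p : ℝ≥0∞) : ℝ≥0∞ :=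
  (∏ i ∈ e, ENNReal.ofReal (t i) ^ (-α)) * modulus G ℓ e f t p

/-- The quasi-seminorm `|f|_{B^{α,e}_{p,θ}}`. The parameter `t` runs over `(0,1]^d`, where the
powers of the `t_i` are finite. -/
def besovSeminorm {d : ℕ} (G : Domain) (ℓ : ℕ) (α : ℝ) (p θ : ℝ≥0∞) (e : Finset (Fin d))
    (f : (Fin d → ℝ) → ℂ) : ℝ≥0∞ :=
  if θ = ∞ then
    ⨆ t ∈ Set.univ.pi fun _ : Fin d => Set.Ioc (0 : ℝ) 1, weightedModulus G ℓ α e f t p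
  else
    (∫⁻ t in Set.univ.pi fun _ : Fin d => Set.Ioc (0 : ℝ) 1,
      weightedModulus G ℓ α e f t p ^ θ.toReal * ∏ i ∈ e, (ENNReal.ofReal (t i))⁻¹) ^
        (1 / θ.toReal)

/-- The Besov quasi-norm of mixed smoothness `α`, built with differences of order `ℓ > α`. -/
def besovNorm {d : ℕ} (G : Domain) (ℓ : ℕ) (α : ℝ) (p θ : ℝ≥0∞) (f : (Fin d → ℝ) → ℂ) : ℝ≥0∞ :=
  ∑ e : Finset (Fin d), besovSeminorm G ℓ α p θ e f

/-- The unit ball `U^α_{p,θ}(𝔾^d)`. For `α > 1/p` every element of the Besov space has exactly one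
continuous representative, and it is this representative which is sampled. -/
def unitBall (G : Domain) (d ℓ : ℕ) (α : ℝ) (p θ : ℝ≥0∞) : Set ((Fin d → ℝ) → ℂ) :=
  {f | IsContinuousOn G f ∧ besovNorm G ℓ α p θ f ≤ 1}

/-- The nodes `I_k = {2^{-k} l : l = 0, …, 2^k - 1}`. -/
def nodes (k : ℕ) : Finset ℝ :=
  (Finset.range (2 ^ k)).image fun l : ℕ => (l : ℝ) / 2 ^ k

/-- The Smolyak grid `G^d(m)`, the union of the products `I_{k_1} × ⋯ × I_{k_d}` over all
`k` with `k_1 + ⋯ + k_d ≤ m`. -/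
def smolyakGrid (d m : ℕ) : Finset (Fin d → ℝ) :=
  ((Fintype.piFinset fun _ : Fin d => Finset.range (m + 1)).filter fun k => ∑ i, k i ≤ m).biUnion
    fun k => Fintype.piFinset fun i => nodes (k i)

theorem mem_smolyakGrid {d m : ℕ} {x : Fin d → ℝ} :
    x ∈ smolyakGrid d m ↔ ∃ k : Fin d → ℕ, ∑ i, k i ≤ m ∧ ∀ i, x i ∈ nodes (k i) := by
  simp only [smolyakGrid, Finset.mem_biUnion, Finset.mem_filter, Fintype.mem_piFinset,
    Finset.mem_range]
  constructor
  · rintro ⟨k, ⟨_, hk⟩, hx⟩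
    exact ⟨k, hk, hx⟩
  · rintro ⟨k, hk, hx⟩
    refine ⟨k, ⟨fun i => ?_, hk⟩, hx⟩
    exact Nat.lt_succ_of_le
      ((Finset.single_le_sum (f := k) (fun _ _ => Nat.zero_le _) (Finset.mem_univ i)).trans hk)

/-- The linear sampling algorithm `S_m(Φ,f) = ∑_{ξ ∈ G^d(m)} f(ξ) φ_ξ`. -/
def samplingAlgorithm {d : ℕ} (m : ℕ) (Φ : (Fin d → ℝ) → (Fin d → ℝ) → ℂ)
    (f : (Fin d → ℝ) → ℂ) : (Fin d → ℝ) → ℂ :=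
  fun x => ∑ ξ ∈ smolyakGrid d m, f ξ * Φ ξ x

/-- The quantity `r^s_n(F)_q` of optimal sampling recovery on Smolyak grids: the infimum over all `m`
with `|G^d(m)| ≤ n` and all families `Φ` of measurable functions of the worst-case `L_q` error
over the class `F`. -/
def optimalRecovery {d : ℕ} (n : ℕ) (F : Set ((Fin d → ℝ) → ℂ)) (q : ℝ≥0∞) : ℝ≥0∞ :=
  ⨅ (m : ℕ) (_ : (smolyakGrid d m).card ≤ n) (Φ : (Fin d → ℝ) → (Fin d → ℝ) → ℂ)
    (_ : ∀ ξ ∈ smolyakGrid d m, AEStronglyMeasurable (Φ ξ) (volume.restrict (unitCube d))),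
    ⨆ f ∈ F, lpQuasiNorm (f - samplingAlgorithm m Φ f) q

end SmolyakSampling

end

noncomputable section

namespace SmolyakSampling

/-! ### Finite differences on the line -/

/-! The bound comes from fooling functions. If `f` lies in the unit ball and vanishes on the grid,
every algorithm returns `0` for it, so the worst-case error is at least `‖f‖_q`
(`le_optimalRecovery`).

Take `f = A ∑_{k ∈ K} ∏ i, u_{k i}(x i)`, where `K` consists of levels with `∑ k i = m` and `u_κ` is
nonnegative, smooth at scale `2^{-κ}` and zero on all nodes of level at most `κ`. If `∑ j i ≤ m' ≤
m`, then `j i ≤ k i` for some `i`, so every summand vanishes on the grid of order `m'`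
(`tensorSum_eq_zero`).

If the univariate `L_p` norms decay like `2^{-ηκ}`, the Besov norm of `f` is at most a constant
times `A 2^{(α-η)m} |K|^{1/θ}` (`exists_besovNorm_tensorSum_le`): after weighting by `t^{-α}`, the
differences of the `k`-th summand are concentrated near `t i ≈ 2^{-k i}`, so different levels hardly
interact. From below, `‖f‖_q` is at least a constant times `A 2^{-ζm} |K|^β`. Normalising `A` leaves
`2^{-(α-η+ζ)m} |K|^{β-1/θ}`.

Two families of atoms give the two rates. `wave` fills the whole period: `η = ζ = 0`, and the
summands overlap on a set of fixed measure, so `β = 1`. `tile` has one narrow bump per period: `η =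
1/p`, and the products have disjoint plateaus of volume about `2^{-m}`, so `ζ = β = 1/q`. Taking for
`K` all levels, about `m^{d-1}` of them, or a single level, according to the sign of `β - 1/θ`,
produces the positive part in the exponent. Finally `m` is chosen with `2^m m^{d-1}` of order `n`
(`exists_level`). -/

/-- The `ℓ`-th difference of a real function on the line. -/
def lineDiff (ℓ : ℕ) (t : ℝ) (v : ℝ → ℝ) (x : ℝ) : ℝ :=
  ∑ j ∈ Finset.range (ℓ + 1), (-1 : ℝ) ^ (ℓ - j) * (ℓ.choose j : ℝ) * v (x + j * t)

theorem fwdDiff_iter_eq_lineDiff (ℓ : ℕ) (t : ℝ) (v : ℝ → ℝ) (x : ℝ) :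
    (fwdDiff t)^[ℓ] v x = lineDiff ℓ t v x := by
  rw [fwdDiff_iter_eq_sum_shift, lineDiff]
  refine Finset.sum_congr rfl fun j _ => ?_
  simp [zsmul_eq_mul]

/-- Differencing every member of a chain of successive derivatives gives such a chain again, one
shorter; the mean value inequality at its end costs a factor `|h|`. The explicit chain lets the
periodised atoms below be treated without computing their iterated derivatives. -/
theorem abs_fwdDiff_iter_le {ℓ : ℕ} {F : ℕ → ℝ → ℝ} {B h : ℝ}
    (hF : ∀ i < ℓ, ∀ x, HasDerivAt (F i) (F (i + 1) x) x) (hB : ∀ x, |F ℓ x| ≤ B) (x : ℝ) :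
    |(fwdDiff h)^[ℓ] (F 0) x| ≤ |h| ^ ℓ * B := by
  induction ℓ generalizing F B with
  | zero => simpa using hB x
  | succ n ih =>
    rw [Function.iterate_succ_apply]
    have key := ih (F := fun i => fwdDiff h (F i)) (B := B * |h|) ?_ ?_
    · refine key.trans (le_of_eq ?_)
      ring
    · intro i hi y
      have h1 := hF i (by omega) (y + h)
      have h2 := hF i (by omega) y
      exact (h1.comp_add_const y h).sub h2
    · intro y
      have := Convex.norm_image_sub_le_of_norm_hasDerivWithin_le (f := F n) (f' := F (n + 1))
        (s := Set.univ) (x := y) (y := y + h) (C := B)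
        (fun z _ => (hF n (by omega) z).hasDerivWithinAt) (fun z _ => by simpa using hB z)
        convex_univ (Set.mem_univ _) (Set.mem_univ _)
      simpa [fwdDiff] using this

theorem abs_lineDiff_le_two_pow {ℓ : ℕ} {v : ℝ → ℝ} (hv : ∀ x, |v x| ≤ 1) (t x : ℝ) :
    |lineDiff ℓ t v x| ≤ 2 ^ ℓ := by
  have h2 : (2 : ℝ) ^ ℓ = ∑ j ∈ Finset.range (ℓ + 1), (ℓ.choose j : ℝ) := by
    exact_mod_cast (Nat.sum_range_choose ℓ).symm
  rw [h2]
  refine (Finset.abs_sum_le_sum_abs _ _).trans (Finset.sum_le_sum fun j _ => ?_)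
  rw [abs_mul, abs_mul, abs_pow, abs_neg, abs_one, one_pow, one_mul, Nat.abs_cast]
  exact mul_le_of_le_one_right (Nat.cast_nonneg _) (hv _)

/-- Univariate building blocks at the dyadic levels `k`, together with the size of their
differences; `η` measures the decay of their `L_p` norms in `k`. -/
structure IsAtomFamily (ℓ : ℕ) (p : ℝ≥0∞) (η C : ℝ) (u : ℕ → ℝ → ℝ) : Prop where
  continuous : ∀ k, Continuous (u k)
  periodic : ∀ k, Function.Periodic (u k) 1
  nonneg : ∀ k x, 0 ≤ u k x
  le_one : ∀ k x, u k x ≤ 1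
  eq_zero : ∀ k j x, j ≤ k → x ∈ nodes j → u k x = 0
  measure_le : ∀ k : ℕ, ∃ S, MeasurableSet S ∧
    volume (S ∩ Set.Icc 0 1) ^ (1 / p.toReal) ≤ ENNReal.ofReal (C * 2 ^ (-(η * k))) ∧
    ∀ x, |u k x| ≤ S.indicator (fun _ => C) x
  diff_le : ∀ (k : ℕ) (h : ℝ), ∃ S, MeasurableSet S ∧
    volume (S ∩ Set.Icc 0 1) ^ (1 / p.toReal) ≤ ENNReal.ofReal (C * 2 ^ (-(η * k))) ∧
    ∀ x, |lineDiff ℓ h (u k) x| ≤ S.indicator (fun _ => C * min 1 ((2 ^ k * |h|) ^ ℓ)) x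

/-- The two bounds on a difference come from `|u| ≤ 1` and from the `ℓ`-th derivative. The
difference lives on the union of `ℓ + 1` translates of the support of `u k`, hence the factor `ℓ +
1` and the uniformity in the shift `y` in `hV`. -/
theorem isAtomFamily_of_chain {ℓ : ℕ} {p : ℝ≥0∞} {η B V : ℝ} {u : ℕ → ℝ → ℝ}
    (continuous : ∀ k, Continuous (u k))
    (periodic : ∀ k, Function.Periodic (u k) 1)
    (nonneg : ∀ k x, 0 ≤ u k x)
    (le_one : ∀ k x, u k x ≤ 1)
    (eq_zero : ∀ k j x, j ≤ k → x ∈ nodes j → u k x = 0)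
    (hV : ∀ (k : ℕ) (y : ℝ), ((ℓ + 1 : ℕ) * volume ({x | u k (x + y) ≠ 0} ∩ Set.Icc 0 1)) ^ (1 / p.toReal) ≤
      ENNReal.ofReal (V * 2 ^ (-(η * k))))
    (hu : ∀ k, ∃ F : ℕ → ℝ → ℝ, F 0 = u k ∧ (∀ i < ℓ, ∀ x, HasDerivAt (F i) (F (i + 1) x) x) ∧
      ∀ x, |F ℓ x| ≤ (2 ^ k) ^ ℓ * B) :
    ∃ C, 1 ≤ C ∧ IsAtomFamily ℓ p η C u := by
  have habs : ∀ k x, |u k x| ≤ 1 := fun k x => by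
    rw [abs_of_nonneg (nonneg k x)]; exact le_one k x
  set C := max (max 1 (2 ^ ℓ)) (max B V) with hC
  have hC1 : 1 ≤ C := (le_max_left _ _).trans (le_max_left _ _)
  have hC2 : (2 : ℝ) ^ ℓ ≤ C := (le_max_right _ _).trans (le_max_left _ _)
  have hCB : B ≤ C := (le_max_left _ _).trans (le_max_right _ _)
  have hCV : V ≤ C := (le_max_right _ _).trans (le_max_right _ _)
  have hopen : ∀ k y, IsOpen {x | u k (x + y) ≠ 0} := fun k y =>
    isOpen_ne_fun ((continuous k).comp (continuous_id.add continuous_const)) continuous_const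
  have hmono : ∀ k : ℕ, ENNReal.ofReal (V * 2 ^ (-(η * k))) ≤
      ENNReal.ofReal (C * 2 ^ (-(η * k))) := fun k =>
    ENNReal.ofReal_le_ofReal (mul_le_mul_of_nonneg_right hCV (Real.rpow_nonneg (by norm_num) _))
  have h0p : 0 ≤ 1 / p.toReal := by positivity
  refine ⟨C, hC1, continuous, periodic, nonneg, le_one, eq_zero, fun k => ?_, fun k h => ?_⟩
  · refine ⟨{x | u k (x + 0) ≠ 0}, (hopen k 0).measurableSet, ?_, fun x => ?_⟩
    · refine le_trans (ENNReal.rpow_le_rpow ?_ h0p) ((hV k 0).trans (hmono k))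
      refine le_mul_of_one_le_left (zero_le) ?_
      exact_mod_cast Nat.succ_le_succ (Nat.zero_le ℓ)
    · by_cases hx : u k x = 0
      · simp [hx]
      · rw [Set.indicator_of_mem (by simpa using hx)]
        exact (habs k x).trans hC1
  · obtain ⟨F, hF0, hF, hFB⟩ := hu k
    refine ⟨⋃ j ∈ Finset.range (ℓ + 1), {x | u k (x + j * h) ≠ 0}, ?_, ?_, fun x => ?_⟩
    · exact Finset.measurableSet_biUnion _ fun j _ => (hopen k _).measurableSet
    -- When `p = ∞` the exponent `1 / p.toReal` is `0`, and every measure raised to it is `1`;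
    -- otherwise a root can be taken.
    · rcases eq_or_lt_of_le h0p with h0 | h0
      · have := hV k 0
        rw [← h0, ENNReal.rpow_zero] at this ⊢
        exact this.trans (hmono k)
      · have hc : ((ℓ + 1 : ℕ) : ℝ≥0∞) ≠ 0 := by simp
        have hc' : ((ℓ + 1 : ℕ) : ℝ≥0∞) ≠ ∞ := ENNReal.natCast_ne_top _
        have hroot : ∀ y, (ℓ + 1 : ℕ) * volume ({x | u k (x + y) ≠ 0} ∩ Set.Icc 0 1) ≤
            (ENNReal.ofReal (V * 2 ^ (-(η * k)))) ^ (1 / p.toReal)⁻¹ := fun y => by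
          rw [ENNReal.le_rpow_inv_iff h0]
          exact hV k y
        rw [← ENNReal.le_rpow_inv_iff h0]
        rw [Set.iUnion₂_inter]
        refine (measure_biUnion_finset_le _ _).trans ?_
        have : ∀ j ∈ Finset.range (ℓ + 1), volume ({x | u k (x + j * h) ≠ 0} ∩ Set.Icc 0 1) ≤
            (ENNReal.ofReal (V * 2 ^ (-(η * k)))) ^ (1 / p.toReal)⁻¹ / (ℓ + 1 : ℕ) := by
          intro j _
          rw [ENNReal.le_div_iff_mul_le (Or.inl hc) (Or.inl hc'), mul_comm]
          exact hroot _
        refine (Finset.sum_le_sum this).trans ?_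
        rw [Finset.sum_const, Finset.card_range, nsmul_eq_mul, ENNReal.mul_div_cancel hc hc']
        exact ENNReal.rpow_le_rpow (hmono k) (by positivity)
    · by_cases hx : x ∈ ⋃ j ∈ Finset.range (ℓ + 1), {x | u k (x + j * h) ≠ 0}
      · rw [Set.indicator_of_mem hx, mul_min_of_nonneg _ _ (zero_le_one.trans hC1), mul_one]
        refine le_min ((abs_lineDiff_le_two_pow (habs k) h x).trans hC2) ?_
        rw [← fwdDiff_iter_eq_lineDiff, ← hF0]
        refine (abs_fwdDiff_iter_le hF hFB x).trans ?_
        calc |h| ^ ℓ * ((2 ^ k) ^ ℓ * B) = B * (2 ^ k * |h|) ^ ℓ := by rw [mul_pow]; ring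
          _ ≤ _ := mul_le_mul_of_nonneg_right hCB (by positivity)
      · rw [Set.indicator_of_notMem hx]
        have : lineDiff ℓ h (u k) x = 0 := by
          refine Finset.sum_eq_zero fun j hj => ?_
          have : u k (x + j * h) = 0 := by
            by_contra hne
            exact hx (Set.mem_biUnion (Finset.mem_coe.2 hj) hne)
          rw [this, mul_zero]
        rw [this, abs_zero]

/-! ### Dyadic dilates of a smooth bump -/

/-- A smooth bump which is `1` on `[11/16, 13/16]` and is supported in `[5/8, 7/8]`. -/
def bump : ContDiffBump (3 / 4 : ℝ) := ⟨1 / 16, 1 / 8, by norm_num, by norm_num⟩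

theorem bump_eq_zero {x : ℝ} (hx : x ∉ Set.Icc (5 / 8 : ℝ) (7 / 8)) : bump x = 0 := by
  refine bump.zero_of_le_dist ?_
  rw [Real.dist_eq]
  change (1 / 8 : ℝ) ≤ _
  by_contra! h
  rw [abs_lt] at h
  exact hx ⟨by linarith, by linarith⟩

theorem bump_eq_one {x : ℝ} (hx : x ∈ Set.Icc (11 / 16 : ℝ) (13 / 16)) : bump x = 1 := by
  refine bump.one_of_mem_closedBall ?_
  rw [Metric.mem_closedBall, Real.dist_eq]
  change _ ≤ (1 / 16 : ℝ)
  rw [abs_le]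
  constructor <;> linarith [hx.1, hx.2]

theorem bump_intCast (z : ℤ) : bump (z : ℝ) = 0 := by
  refine bump_eq_zero fun h => ?_
  have h1 : (0 : ℝ) < z := by linarith [h.1]
  have h2 : (z : ℝ) < 1 := by linarith [h.2]
  norm_cast at h1 h2
  omega

theorem bumpDeriv_eq_zero (i : ℕ) {x : ℝ} (hx : x ∉ Set.Icc (5 / 8 : ℝ) (7 / 8)) :
    iteratedDeriv i bump x = 0 := by
  induction i generalizing x with
  | zero => simpa using bump_eq_zero hx
  | succ n ih =>
    rw [iteratedDeriv_succ]
    have : iteratedDeriv n bump =ᶠ[nhds x] fun _ => 0 := by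
      filter_upwards [isClosed_Icc.isOpen_compl.mem_nhds hx] with y hy using ih hy
    rw [this.deriv_eq, deriv_const]

theorem hasDerivAt_bumpDeriv (i : ℕ) (x : ℝ) :
    HasDerivAt (iteratedDeriv i bump) (iteratedDeriv (i + 1) bump x) x := by
  rw [iteratedDeriv_succ]
  have h : ContDiff ℝ (i + 1 : ℕ) bump := bump.contDiff
  exact ((h.differentiable_iteratedDeriv i (by exact_mod_cast Nat.lt_succ_self i)) x).hasDerivAt

theorem exists_bumpDeriv_bound (i : ℕ) : ∃ B, ∀ x, |iteratedDeriv i bump x| ≤ B := by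
  have hs : HasCompactSupport (iteratedDeriv i bump) :=
    HasCompactSupport.intro isCompact_Icc fun x hx => bumpDeriv_eq_zero i hx
  obtain ⟨B, hB⟩ := hs.exists_bound_of_continuous
    (continuous_iff_continuousAt.2 fun x => (hasDerivAt_bumpDeriv i x).continuousAt)
  exact ⟨B, fun x => hB x⟩

/-- The `1`-periodic function with one bump of width `2^{-k}` in each period. -/
def tile (k : ℕ) (x : ℝ) : ℝ := bump (2 ^ k * Int.fract x)

/-- The `2^{-k}`-periodic function with one bump in each period. -/
def wave (k : ℕ) (x : ℝ) : ℝ := tile 0 (2 ^ k * x)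

/-- The jumps of `Int.fract` at the integers do no harm: there the argument of the bump is outside
its support on both sides, so the function is locally zero. -/
theorem hasDerivAt_tileDeriv (k i : ℕ) (x : ℝ) :
    HasDerivAt (fun y => (2 ^ k) ^ i * iteratedDeriv i bump (2 ^ k * Int.fract y))
      ((2 ^ k) ^ (i + 1) * iteratedDeriv (i + 1) bump (2 ^ k * Int.fract x)) x := by
  have h2k : (1 : ℝ) ≤ 2 ^ k := one_le_pow₀ (by norm_num)
  by_cases hx : Int.fract x = 0
  · have hxf : x = (⌊x⌋ : ℝ) := by
      have := Int.self_sub_floor x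
      linarith
    have h0 : iteratedDeriv (i + 1) bump (2 ^ k * Int.fract x) = 0 :=
      bumpDeriv_eq_zero _ (by rw [hx, mul_zero]; norm_num)
    rw [h0, mul_zero]
    refine (hasDerivAt_const x (0 : ℝ)).congr_of_eventuallyEq ?_
    -- To the left of the integer `x` the argument exceeds `15/16 > 7/8`, to the right it is below
    -- `1/2 < 5/8`.
    have hnhds : Set.Ioo (x - 1 / 16) (x + 1 / (2 * 2 ^ k)) ∈ nhds x :=
      Ioo_mem_nhds (by linarith) (by have : (0 : ℝ) < 1 / (2 * 2 ^ k) := by positivity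
                                     linarith)
    filter_upwards [hnhds] with y hy
    have hle : 1 / (2 * (2 : ℝ) ^ k) ≤ 1 / 2 :=
      one_div_le_one_div_of_le (by norm_num) (by linarith)
    suffices h : 2 ^ k * Int.fract y ∉ Set.Icc (5 / 8 : ℝ) (7 / 8) by
      rw [bumpDeriv_eq_zero i h, mul_zero]
    rintro ⟨h1, h2⟩
    rcases lt_or_ge y x with hlt | hge
    · have hfl : ⌊y⌋ = ⌊x⌋ - 1 := by
        rw [Int.floor_eq_iff]
        push_cast
        constructor <;> linarith [hy.1]
      have hf : Int.fract y = y - x + 1 := by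
        rw [Int.fract, hfl]
        push_cast
        linarith
      nlinarith [hy.1, Int.fract_nonneg y]
    · have hfl : ⌊y⌋ = ⌊x⌋ := by
        rw [Int.floor_eq_iff]
        constructor <;> linarith [hy.2]
      have hf : Int.fract y = y - x := by
        rw [Int.fract, hfl, ← hxf]
      have : 2 ^ k * Int.fract y < 2 ^ k * (1 / (2 * 2 ^ k)) := by
        refine mul_lt_mul_of_pos_left ?_ (by linarith)
        rw [hf]; linarith [hy.2]
      have h3 : (2 : ℝ) ^ k * (1 / (2 * 2 ^ k)) = 1 / 2 := by field_simp
      linarith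
  · have hpos : 0 < Int.fract x := lt_of_le_of_ne (Int.fract_nonneg x) (Ne.symm hx)
    have hxf : x = ⌊x⌋ + Int.fract x := (Int.floor_add_fract x).symm
    have hev : (fun y => (2 ^ k) ^ i * iteratedDeriv i bump (2 ^ k * Int.fract y)) =ᶠ[nhds x]
        fun y => (2 ^ k) ^ i * iteratedDeriv i bump (2 ^ k * (y - ⌊x⌋)) := by
      have : Set.Ioo (⌊x⌋ : ℝ) (⌊x⌋ + 1) ∈ nhds x :=
        Ioo_mem_nhds (by linarith) (Int.lt_floor_add_one x)
      filter_upwards [this] with y hy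
      have : ⌊y⌋ = ⌊x⌋ := by
        rw [Int.floor_eq_iff]
        exact ⟨hy.1.le, hy.2⟩
      rw [Int.fract, this]
    refine HasDerivAt.congr_of_eventuallyEq ?_ hev
    have hin : HasDerivAt (fun y : ℝ => 2 ^ k * (y - ⌊x⌋)) (2 ^ k * 1) x :=
      ((hasDerivAt_id x).sub_const _).const_mul _
    have := ((hasDerivAt_bumpDeriv i (2 ^ k * (x - ⌊x⌋))).comp x hin).const_mul ((2 ^ k) ^ i)
    refine this.congr_deriv ?_
    rw [Int.self_sub_floor, mul_one, pow_succ]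
    ring

theorem continuous_tile (k : ℕ) : Continuous (tile k) := by
  refine continuous_iff_continuousAt.2 fun x => ?_
  have := (hasDerivAt_tileDeriv k 0 x).continuousAt
  simp only [pow_zero, one_mul, iteratedDeriv_zero] at this
  exact this

theorem periodic_tile (k : ℕ) : Function.Periodic (tile k) 1 := fun x => by
  simp [tile]

/-- A window of length one meets at most two periods, hence at most two bumps; this is the factor
`2`. -/
theorem volume_tile_ne_zero_le (k : ℕ) (y : ℝ) :
    volume ({x | tile k (x + y) ≠ 0} ∩ Set.Icc 0 1) ≤ ENNReal.ofReal (2 * 2 ^ (-(k : ℝ))) := by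
  have h2k : (0 : ℝ) < 2 ^ k := by positivity
  have hδ : (2 : ℝ) ^ (-(k : ℝ)) = (2 ^ k)⁻¹ := by rw [Real.rpow_neg (by norm_num), Real.rpow_natCast]
  rw [hδ]
  have hsub : {x | tile k (x + y) ≠ 0} ∩ Set.Icc 0 1 ⊆
      Set.Icc (⌊y⌋ - y) (⌊y⌋ - y + (2 ^ k)⁻¹) ∪
        Set.Icc (⌊y⌋ + 1 - y) (⌊y⌋ + 1 - y + (2 ^ k)⁻¹) := by
    rintro x ⟨hx, hx0, hx1⟩
    have hmem : 2 ^ k * Int.fract (x + y) ∈ Set.Icc (5 / 8 : ℝ) (7 / 8) := by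
      by_contra hne
      exact hx (bump_eq_zero hne)
    have hfr : Int.fract (x + y) ≤ (2 ^ k)⁻¹ := by
      rw [← one_div, le_div_iff₀ h2k]
      linarith [hmem.2]
    have hfr0 := Int.fract_nonneg (x + y)
    have hlo : ⌊y⌋ ≤ ⌊x + y⌋ := Int.floor_le_floor (by linarith)
    have hhi : ⌊x + y⌋ ≤ ⌊y⌋ + 1 := by
      rw [← Int.floor_add_one]
      exact Int.floor_le_floor (by linarith)
    have heq := Int.floor_add_fract (x + y)
    rcases (by omega : ⌊x + y⌋ = ⌊y⌋ ∨ ⌊x + y⌋ = ⌊y⌋ + 1) with h | h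
    · left
      rw [h] at heq
      constructor <;> linarith
    · right
      rw [h] at heq
      push_cast at heq
      constructor <;> linarith
  refine (measure_mono hsub).trans ((measure_union_le _ _).trans ?_)
  rw [Real.volume_Icc, Real.volume_Icc, ← ENNReal.ofReal_add (by simp) (by simp)]
  refine ENNReal.ofReal_le_ofReal (le_of_eq ?_)
  ring

theorem mem_nodes_two_pow_mul {j k : ℕ} (hjk : j ≤ k) {x : ℝ} (hx : x ∈ nodes j) :
    Int.fract x = x ∧ ∃ z : ℤ, 2 ^ k * x = z := by
  obtain ⟨l, hl, rfl⟩ := Finset.mem_image.1 hx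
  have hl' : (l : ℝ) < 2 ^ j := by exact_mod_cast Finset.mem_range.1 hl
  have h2 : (0 : ℝ) < 2 ^ j := by positivity
  refine ⟨Int.fract_eq_self.2 ⟨by positivity, (div_lt_one h2).2 hl'⟩, (2 ^ (k - j) * l : ℕ), ?_⟩
  obtain ⟨i, rfl⟩ := Nat.exists_eq_add_of_le hjk
  rw [Nat.add_sub_cancel_left, pow_add]
  push_cast
  field_simp

theorem exists_isAtomFamily_tile (ℓ : ℕ) (p : ℝ≥0∞) :
    ∃ C, 1 ≤ C ∧ IsAtomFamily ℓ p (p⁻¹).toReal C tile := by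
  obtain ⟨B, hB⟩ := exists_bumpDeriv_bound ℓ
  refine isAtomFamily_of_chain (B := B) (V := ((ℓ + 1 : ℕ) * 2 : ℝ) ^ (1 / p.toReal))
    continuous_tile periodic_tile (fun k x => bump.nonneg) (fun k x => bump.le_one)
    (fun k j x hjk hx => ?_) (fun k y => ?_) (fun k => ?_)
  · obtain ⟨h1, z, hz⟩ := mem_nodes_two_pow_mul hjk hx
    rw [tile, h1, hz, bump_intCast]
  · refine (ENNReal.rpow_le_rpow (mul_le_mul_right (volume_tile_ne_zero_le k y) _)
      (by positivity)).trans (le_of_eq ?_)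
    rw [← ENNReal.ofReal_natCast (ℓ + 1), ← ENNReal.ofReal_mul (by positivity),
      ENNReal.ofReal_rpow_of_nonneg (by positivity) (by positivity), ← mul_assoc,
      Real.mul_rpow (by positivity) (by positivity), ← Real.rpow_mul (by norm_num)]
    congr 3
    rw [ENNReal.toReal_inv]
    ring
  · refine ⟨fun i x => (2 ^ k) ^ i * iteratedDeriv i bump (2 ^ k * Int.fract x), ?_,
      fun i _ x => hasDerivAt_tileDeriv k i x, fun x => ?_⟩
    · ext x
      simp [tile]
    · rw [abs_mul, abs_of_nonneg (by positivity)]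
      exact mul_le_mul_of_nonneg_left (hB _) (by positivity)

theorem exists_isAtomFamily_wave (ℓ : ℕ) (p : ℝ≥0∞) :
    ∃ C, 1 ≤ C ∧ IsAtomFamily ℓ p 0 C wave := by
  obtain ⟨B, hB⟩ := exists_bumpDeriv_bound ℓ
  refine isAtomFamily_of_chain (B := B) (V := ((ℓ + 1 : ℕ) : ℝ) ^ (1 / p.toReal))
    (fun k => (continuous_tile 0).comp (continuous_const.mul continuous_id)) (fun k x => ?_)
    (fun k x => bump.nonneg) (fun k x => bump.le_one)
    (fun k j x hjk hx => ?_) (fun k y => ?_) (fun k => ?_)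
  · have := (periodic_tile 0).nat_mul (2 ^ k) (2 ^ k * x)
    simp only [wave, mul_add]
    rw [← this]
    push_cast
    ring_nf
  · obtain ⟨-, z, hz⟩ := mem_nodes_two_pow_mul hjk hx
    rw [wave, hz, tile, Int.fract_intCast, mul_zero]
    exact_mod_cast bump_intCast 0
  · have : volume ({x | wave k (x + y) ≠ 0} ∩ Set.Icc 0 1) ≤ 1 :=
      (measure_mono Set.inter_subset_right).trans (by simp)
    refine (ENNReal.rpow_le_rpow (mul_le_mul_right this _) (by positivity)).trans (le_of_eq ?_)
    rw [zero_mul, neg_zero, Real.rpow_zero, mul_one, mul_one, ← ENNReal.ofReal_natCast (ℓ + 1),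
      ENNReal.ofReal_rpow_of_nonneg (by positivity) (by positivity)]
  · refine ⟨fun i x => (2 ^ k) ^ i * iteratedDeriv i bump (Int.fract (2 ^ k * x)), ?_,
      fun i _ x => ?_, fun x => ?_⟩
    · ext x
      simp [wave, tile]
    · have h1 := hasDerivAt_tileDeriv 0 i (2 ^ k * x)
      have h2 : HasDerivAt (fun y : ℝ => 2 ^ k * y) (2 ^ k * 1) x :=
        (hasDerivAt_id x).const_mul _
      have := (h1.comp x h2).const_mul ((2 ^ k : ℝ) ^ i)
      simp only [pow_zero, one_pow, one_mul, mul_one] at this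
      refine this.congr_deriv ?_
      ring
    · rw [abs_mul, abs_of_nonneg (by positivity)]
      exact mul_le_mul_of_nonneg_left (hB _) (by positivity)

/-! ### Quasi-norm inequalities -/

theorem ennreal_rpow_sum_le {ι : Type*} (s : Finset ι) (a : ι → ℝ≥0∞) {r : ℝ} (hr : 0 < r)
    (hr1 : r ≤ 1) : (∑ k ∈ s, a k) ^ r ≤ ∑ k ∈ s, a k ^ r :=
  Finset.le_sum_of_subadditive (fun x : ℝ≥0∞ => x ^ r) (ENNReal.zero_rpow_of_pos hr).le
    (fun x y => ENNReal.rpow_add_le_add_rpow x y hr.le hr1) s a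

/-- The `r`-triangle inequality, valid for `r ≤ min 1 p`. It treats the quasi-normed range `p < 1`
together with `p ≥ 1`. -/
theorem eLpNorm_sum_rpow_le {Ω ι : Type*} [MeasurableSpace Ω] {μ : Measure Ω} {p : ℝ≥0∞}
    (s : Finset ι) (f : ι → Ω → ℝ) (hf : ∀ k ∈ s, AEStronglyMeasurable (f k) μ) {r : ℝ}
    (hr : 0 < r) (hr1 : r ≤ 1) (hrp : ENNReal.ofReal r ≤ p) :
    eLpNorm (fun x => ∑ k ∈ s, f k x) p μ ^ r ≤ ∑ k ∈ s, eLpNorm (f k) p μ ^ r := by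
  have hp0 : p ≠ 0 := by
    rintro rfl
    simp only [nonpos_iff_eq_zero, ENNReal.ofReal_eq_zero] at hrp
    linarith
  rcases le_or_gt 1 p with hp | hp
  · have := eLpNorm_sum_le hf hp
    have h2 : (fun x => ∑ k ∈ s, f k x) = ∑ k ∈ s, f k := by
      ext x
      simp
    rw [h2]
    exact (ENNReal.rpow_le_rpow this hr.le).trans (ennreal_rpow_sum_le s _ hr hr1)
  · have hpt : p ≠ ∞ := (hp.trans ENNReal.one_lt_top).ne
    have hpos : 0 < p.toReal := ENNReal.toReal_pos hp0 hpt
    have hp1 : p.toReal ≤ 1 := by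
      simpa using ENNReal.toReal_mono ENNReal.one_ne_top hp.le
    have hrp' : r ≤ p.toReal := by
      rwa [ENNReal.ofReal_le_iff_le_toReal hpt] at hrp
    have key : (∫⁻ x, ‖∑ k ∈ s, f k x‖ₑ ^ p.toReal ∂μ) ≤
        ∑ k ∈ s, ∫⁻ x, ‖f k x‖ₑ ^ p.toReal ∂μ := by
      rw [← lintegral_finsetSum' _ fun k hk => (hf k hk).enorm.pow_const _]
      refine lintegral_mono fun x => ?_
      exact (ENNReal.rpow_le_rpow (enorm_sum_le _ _) hpos.le).trans
        (ennreal_rpow_sum_le s _ hpos hp1)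
    have hexp : 1 / p.toReal * r ≤ 1 := by
      rw [one_div, inv_mul_le_iff₀ hpos, mul_one]
      exact hrp'
    simp only [eLpNorm_eq_lintegral_rpow_enorm_toReal hp0 hpt, ← ENNReal.rpow_mul]
    exact (ENNReal.rpow_le_rpow key (by positivity)).trans
      (ennreal_rpow_sum_le s _ (by positivity) hexp)

theorem lpQuasiNorm_rpow_le {d : ℕ} {ι : Type*} {p : ℝ≥0∞} (s : Finset ι)
    {F : (Fin d → ℝ) → ℂ} {c : ι → ℝ} {R : ι → Set (Fin d → ℝ)} (hc : ∀ k ∈ s, 0 ≤ c k)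
    (hR : ∀ k ∈ s, MeasurableSet (R k))
    (hF : ∀ x, ‖F x‖ ≤ ∑ k ∈ s, (R k).indicator (fun _ => c k) x) {r : ℝ}
    (hr : 0 < r) (hr1 : r ≤ 1) (hrp : ENNReal.ofReal r ≤ p) :
    lpQuasiNorm F p ^ r ≤
      ∑ k ∈ s, (ENNReal.ofReal (c k) * volume (R k ∩ unitCube d) ^ (1 / p.toReal)) ^ r := by
  have h1 : lpQuasiNorm F p ≤ eLpNorm (fun x => ∑ k ∈ s, (R k).indicator (fun _ => c k) x) p
      (volume.restrict (unitCube d)) := eLpNorm_mono_real hF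
  refine (ENNReal.rpow_le_rpow h1 hr.le).trans ?_
  refine (eLpNorm_sum_rpow_le s (fun k => (R k).indicator fun _ => c k)
    (fun k hk => (stronglyMeasurable_const.indicator (hR k hk)).aestronglyMeasurable)
    hr hr1 hrp).trans ?_
  refine Finset.sum_le_sum fun k hk => ENNReal.rpow_le_rpow ?_ hr.le
  refine (eLpNorm_indicator_const_le _ _).trans (le_of_eq ?_)
  rw [Measure.restrict_apply (hR k hk), Real.enorm_of_nonneg (hc k hk)]

theorem volume_pi_inter_unitCube {d : ℕ} (S : Fin d → Set ℝ) :
    volume (Set.univ.pi S ∩ unitCube d) = ∏ i, volume (S i ∩ Set.Icc 0 1) := by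
  rw [unitCube, ← Set.pi_inter_distrib, volume_pi_pi]

theorem lintegral_pi_prod {n : ℕ} (μ : Fin n → Measure ℝ) [∀ i, SigmaFinite (μ i)]
    {f : Fin n → ℝ → ℝ≥0∞} (hf : ∀ i, Measurable (f i)) :
    ∫⁻ x, ∏ i, f i (x i) ∂(Measure.pi μ) = ∏ i, ∫⁻ y, f i y ∂(μ i) := by
  induction n with
  | zero => simp
  | succ n ih =>
    have hmp := (measurePreserving_piFinSuccAbove μ 0).symm
    rw [← hmp.lintegral_comp (by fun_prop)]
    simp only [MeasurableEquiv.piFinSuccAbove_symm_apply, Fin.insertNthEquiv, Equiv.coe_fn_mk,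
      Fin.insertNth_zero, Fin.prod_univ_succ, Fin.cons_zero, Fin.cons_succ, Fin.zero_succAbove, cast_eq]
    rw [lintegral_prod_mul (f := f 0) (g := fun y : Fin n → ℝ => ∏ i : Fin n, f i.succ (y i))
      (hf 0).aemeasurable
      (Finset.measurable_prod _ fun i _ => (hf i.succ).comp (measurable_pi_apply i)).aemeasurable]
    rw [ih (fun i => μ i.succ) fun i => hf i.succ]

/-! ### Weights -/

/-- The weight `min {(2^κ τ)^ε, (2^κ τ)^{-ε}}`. -/
def weight (ε : ℝ) (κ : ℕ) (τ : ℝ) : ℝ :=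
  min ((2 ^ κ * τ) ^ ε) ((2 ^ κ * τ) ^ (-ε))

theorem weight_nonneg {ε : ℝ} (κ : ℕ) {τ : ℝ} (hτ : 0 ≤ τ) : 0 ≤ weight ε κ τ :=
  le_min (by positivity) (by positivity)

theorem measurable_weight (ε : ℝ) (κ : ℕ) : Measurable (weight ε κ) := by
  unfold weight
  fun_prop

theorem weight_le_one {ε : ℝ} (hε : 0 ≤ ε) (κ : ℕ) {τ : ℝ} (hτ : 0 < τ) : weight ε κ τ ≤ 1 := by
  rcases le_total (2 ^ κ * τ) 1 with h | h
  · exact (min_le_left _ _).trans (Real.rpow_le_one (by positivity) h hε)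
  · exact (min_le_right _ _).trans (Real.rpow_le_one_of_one_le_of_nonpos h (by linarith))

theorem sum_pow_le_of_injOn {x : ℝ} (hx0 : 0 ≤ x) (hx1 : x < 1) (s : Finset ℕ) (g : ℕ → ℕ)
    (hg : Set.InjOn g s) : ∑ κ ∈ s, x ^ g κ ≤ (1 - x)⁻¹ := by
  rw [← Finset.sum_image (f := fun j => x ^ j) hg, ← tsum_geometric_of_lt_one hx0 hx1]
  exact (summable_geometric_of_lt_one hx0 hx1).sum_le_tsum _ fun i _ => by positivity

/-- The weights peak at `2^κ ≈ 1/τ` and decay geometrically on both sides; splitting at `2^n ≤ 1/τ <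
2^(n+1)` leaves two geometric series. -/
theorem sum_weight_le {ε : ℝ} (hε : 0 < ε) {τ : ℝ} (hτ : 0 < τ) (hτ1 : τ ≤ 1) (s : Finset ℕ) :
    ∑ κ ∈ s, weight ε κ τ ≤ 2 * (1 - (2 : ℝ) ^ (-ε))⁻¹ := by
  obtain ⟨n, hn1, hn2⟩ := exists_nat_pow_near (one_le_one_div hτ hτ1) (by norm_num : (1 : ℝ) < 2)
  rw [le_div_iff₀ hτ] at hn1
  rw [div_lt_iff₀ hτ] at hn2
  have hx0 : 0 ≤ (2 : ℝ) ^ (-ε) := by positivity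
  have hx1 : (2 : ℝ) ^ (-ε) < 1 := Real.rpow_lt_one_of_one_lt_of_neg (by norm_num) (by linarith)
  rw [← Finset.sum_filter_add_sum_filter_not s (· ≤ n), two_mul]
  refine add_le_add ?_ ?_
  · refine (Finset.sum_le_sum (g := fun κ => ((2 : ℝ) ^ (-ε)) ^ (n - κ)) fun κ hκ => ?_).trans
      (sum_pow_le_of_injOn hx0 hx1 _ _ ?_)
    · have hκ' : κ ≤ n := (Finset.mem_filter.1 hκ).2
      refine (min_le_left _ _).trans ?_
      have : 2 ^ κ * τ ≤ (2 : ℝ) ^ (-((n - κ : ℕ) : ℝ)) := by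
        rw [Real.rpow_neg (by norm_num), Real.rpow_natCast, ← one_div, le_div_iff₀ (by positivity)]
        calc 2 ^ κ * τ * 2 ^ (n - κ) = 2 ^ (κ + (n - κ)) * τ := by rw [pow_add]; ring
          _ ≤ 1 := by rw [Nat.add_sub_cancel' hκ']; exact hn1
      refine (Real.rpow_le_rpow (by positivity) this hε.le).trans (le_of_eq ?_)
      rw [← Real.rpow_mul (by norm_num), ← Real.rpow_natCast, ← Real.rpow_mul (by norm_num)]
      ring_nf
    · intro a ha b hb hab
      have ha' : a ≤ n := (Finset.mem_filter.1 ha).2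
      have hb' : b ≤ n := (Finset.mem_filter.1 hb).2
      omega
  · refine (Finset.sum_le_sum (g := fun κ => ((2 : ℝ) ^ (-ε)) ^ (κ - (n + 1))) fun κ hκ => ?_).trans
      (sum_pow_le_of_injOn hx0 hx1 _ _ ?_)
    · have hκ' : n + 1 ≤ κ := by have := (Finset.mem_filter.1 hκ).2; omega
      refine (min_le_right _ _).trans ?_
      have : (2 : ℝ) ^ (κ - (n + 1)) ≤ 2 ^ κ * τ := by
        calc (2 : ℝ) ^ (κ - (n + 1)) ≤ 2 ^ (κ - (n + 1)) * (2 ^ (n + 1) * τ) :=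
              le_mul_of_one_le_right (by positivity) hn2.le
          _ = 2 ^ (κ - (n + 1) + (n + 1)) * τ := by rw [pow_add]; ring
          _ = 2 ^ κ * τ := by rw [Nat.sub_add_cancel hκ']
      refine (Real.rpow_le_rpow_of_nonpos (by positivity) this (by linarith)).trans (le_of_eq ?_)
      rw [← Real.rpow_natCast, ← Real.rpow_mul (by norm_num), ← Real.rpow_natCast,
        ← Real.rpow_mul (by norm_num)]
      ring_nf
    · intro a ha b hb hab
      have ha' := (Finset.mem_filter.1 ha).2
      have hb' := (Finset.mem_filter.1 hb).2
      change a - (n + 1) = b - (n + 1) at hab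
      omega

/-- The measure `dτ/τ` is dilation invariant, so the bound does not depend on `κ`. The two sides of
the peak `2^{-κ}` contribute at most `1/ε` each. -/
theorem lintegral_weight_le {ε : ℝ} (hε : 0 < ε) (κ : ℕ) :
    ∫⁻ τ in Set.Ioc (0 : ℝ) 1, ENNReal.ofReal (weight ε κ τ * τ⁻¹) ≤ ENNReal.ofReal (2 / ε) := by
  set δ : ℝ := (2 ^ κ)⁻¹ with hδ
  have hδ0 : 0 < δ := by positivity
  have h2 : (2 : ℝ) ^ κ = δ⁻¹ := by rw [hδ, inv_inv]
  have hsub : Set.Ioc (0 : ℝ) 1 ⊆ Set.Ioc 0 δ ∪ Set.Ioi δ := by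
    intro x hx
    rcases le_or_gt x δ with h | h
    · exact Or.inl ⟨hx.1, h⟩
    · exact Or.inr h
  refine (lintegral_mono_set hsub).trans ((lintegral_union_le _ _ _).trans ?_)
  have e1 : ∫⁻ τ in Set.Ioc 0 δ, ENNReal.ofReal (weight ε κ τ * τ⁻¹) ≤ ENNReal.ofReal (1 / ε) := by
    have hint : IntegrableOn (fun τ : ℝ => δ ^ (-ε) * τ ^ (ε - 1)) (Set.Ioc 0 δ) := by
      have := (intervalIntegral.intervalIntegrable_rpow' (a := 0) (b := δ) (r := ε - 1)
        (by linarith)).const_mul (δ ^ (-ε))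
      rwa [intervalIntegrable_iff_integrableOn_Ioc_of_le hδ0.le] at this
    have hval : ∫ τ in Set.Ioc 0 δ, δ ^ (-ε) * τ ^ (ε - 1) = 1 / ε := by
      rw [← intervalIntegral.integral_of_le hδ0.le, intervalIntegral.integral_const_mul,
        integral_rpow (Or.inl (by linarith)), sub_add_cancel, Real.zero_rpow hε.ne', sub_zero,
        Real.rpow_neg hδ0.le]
      have : δ ^ ε ≠ 0 := (Real.rpow_pos_of_pos hδ0 _).ne'
      field_simp
    rw [← hval, ofReal_integral_eq_lintegral_ofReal hint]
    · refine setLIntegral_mono' measurableSet_Ioc fun τ hτ => ENNReal.ofReal_le_ofReal ?_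
      have hτ0 : 0 < τ := hτ.1
      calc weight ε κ τ * τ⁻¹ ≤ (2 ^ κ * τ) ^ ε * τ⁻¹ :=
            mul_le_mul_of_nonneg_right (min_le_left _ _) (by positivity)
        _ = _ := by
            rw [h2, Real.mul_rpow (by positivity) hτ0.le, Real.inv_rpow hδ0.le,
              ← Real.rpow_neg hδ0.le, Real.rpow_sub hτ0, Real.rpow_one]
            ring
    · refine (ae_restrict_iff' measurableSet_Ioc).2 (Filter.Eventually.of_forall fun τ hτ => ?_)
      have := hτ.1
      simp only [Pi.zero_apply]
      positivity
  have e2 : ∫⁻ τ in Set.Ioi δ, ENNReal.ofReal (weight ε κ τ * τ⁻¹) ≤ ENNReal.ofReal (1 / ε) := by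
    have hint : IntegrableOn (fun τ : ℝ => δ ^ ε * τ ^ (-ε - 1)) (Set.Ioi δ) :=
      (integrableOn_Ioi_rpow_of_lt (by linarith) hδ0).const_mul _
    have hval : ∫ τ in Set.Ioi δ, δ ^ ε * τ ^ (-ε - 1) = 1 / ε := by
      rw [integral_const_mul, integral_Ioi_rpow_of_lt (by linarith) hδ0, sub_add_cancel,
        Real.rpow_neg hδ0.le]
      have : δ ^ ε ≠ 0 := (Real.rpow_pos_of_pos hδ0 _).ne'
      field_simp
    rw [← hval, ofReal_integral_eq_lintegral_ofReal hint]
    · refine setLIntegral_mono' measurableSet_Ioi fun τ hτ => ENNReal.ofReal_le_ofReal ?_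
      have hτ0 : 0 < τ := hδ0.trans hτ
      calc weight ε κ τ * τ⁻¹ ≤ (2 ^ κ * τ) ^ (-ε) * τ⁻¹ :=
            mul_le_mul_of_nonneg_right (min_le_right _ _) (by positivity)
        _ = _ := by
            rw [h2, Real.mul_rpow (by positivity) hτ0.le, Real.inv_rpow hδ0.le,
              Real.rpow_neg hδ0.le, inv_inv, Real.rpow_sub hτ0, Real.rpow_one]
            ring
    · refine (ae_restrict_iff' measurableSet_Ioi).2 (Filter.Eventually.of_forall fun τ hτ => ?_)
      have : 0 < τ := hδ0.trans hτ
      simp only [Pi.zero_apply]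
      positivity
  refine (add_le_add e1 e2).trans (le_of_eq ?_)
  rw [← ENNReal.ofReal_add (by positivity) (by positivity)]
  ring_nf

/-- With `σ = 2^κ τ` the left side is a power of `2` times `(σ^{-α} min(1, σ^ℓ))^r`. This decays as
`σ → ∞` because `α > 0` and as `σ → 0` because `ℓ > α`; the slower of the two rates is the exponent
of the weight. -/
theorem rpow_smoothness_le_weight {α r : ℝ} {ℓ : ℕ} (hr : 0 < r) (hα : 0 < α) (hαℓ : α < ℓ)
    (κ : ℕ) {τ : ℝ} (hτ : 0 < τ) :
    (τ ^ (-α) * min 1 ((2 ^ κ * τ) ^ ℓ)) ^ r ≤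
      2 ^ (α * r * κ) * weight (r * min α (ℓ - α)) κ τ := by
  set σ : ℝ := 2 ^ κ * τ with hσ
  have hσ0 : 0 < σ := by positivity
  have hτσ : τ ^ (-α) = 2 ^ (α * κ) * σ ^ (-α) := by
    have : τ = 2 ^ (-(κ : ℝ)) * σ := by
      rw [hσ, Real.rpow_neg (by norm_num), Real.rpow_natCast]
      field_simp
    rw [this, Real.mul_rpow (by positivity) hσ0.le, ← Real.rpow_mul (by norm_num)]
    ring_nf
  have h2 : (2 : ℝ) ^ (α * r * κ) = (2 ^ (α * κ)) ^ r := by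
    rw [← Real.rpow_mul (by norm_num)]
    ring_nf
  rw [hτσ, mul_assoc, Real.mul_rpow (by positivity) (by positivity), h2]
  refine mul_le_mul_of_nonneg_left ?_ (by positivity)
  have hm : min α (ℓ - α) ≤ α := min_le_left _ _
  have hm' : min α (ℓ - α) ≤ ℓ - α := min_le_right _ _
  have hm0 : 0 < min α (ℓ - α) := lt_min hα (by linarith)
  have hpow : ∀ {a b : ℝ}, 0 ≤ a → a ≤ σ ^ b → a ^ r ≤ σ ^ (r * b) := fun ha hab => by
    refine (Real.rpow_le_rpow ha hab hr.le).trans (le_of_eq ?_)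
    rw [← Real.rpow_mul hσ0.le, mul_comm]
  have ha : 0 ≤ σ ^ (-α) * min 1 (σ ^ ℓ) := by positivity
  rw [weight, ← hσ, ← mul_neg]
  have hℓ : σ ^ (-α) * σ ^ ℓ = σ ^ (ℓ - α) := by
    rw [← Real.rpow_natCast, ← Real.rpow_add hσ0]
    ring_nf
  have b1 : σ ^ (-α) * min 1 (σ ^ ℓ) ≤ σ ^ (-α) :=
    mul_le_of_le_one_right (by positivity) (min_le_left _ _)
  have b2 : σ ^ (-α) * min 1 (σ ^ ℓ) ≤ σ ^ (ℓ - α) := by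
    rw [← hℓ]
    exact mul_le_mul_of_nonneg_left (min_le_right _ _) (by positivity)
  rcases le_total σ 1 with h | h
  · exact le_min
      (hpow ha (b2.trans (Real.rpow_le_rpow_of_exponent_ge hσ0 h hm')))
      (hpow ha (b2.trans (Real.rpow_le_rpow_of_exponent_ge hσ0 h (by linarith))))
  · refine le_min
      (hpow ha (b1.trans (Real.rpow_le_rpow_of_exponent_le h (by linarith))))
      (hpow ha (b1.trans (Real.rpow_le_rpow_of_exponent_le h (by linarith))))

/-! ### Differences of sums of tensor products -/

/-- The scaled sum `A ∑_{k ∈ K} ∏_i v_{k,i}(x_i)` of tensor products. -/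
def tensorSum {d : ℕ} (A : ℝ) (K : Finset (Fin d → ℕ)) (v : (Fin d → ℕ) → Fin d → ℝ → ℝ)
    (x : Fin d → ℝ) : ℂ :=
  ((∑ k ∈ K, A * ∏ i, v k i (x i) : ℝ) : ℂ)

/-- The univariate difference operator on the domain. -/
def domainDiff (G : Domain) (ℓ : ℕ) (t : ℝ) (v : ℝ → ℝ) : ℝ → ℝ :=
  match G with
  | .cube => fun x => if x + ℓ * t ∈ Set.Icc (0 : ℝ) 1 then lineDiff ℓ t v x else 0
  | .torus => lineDiff ℓ t v

/-- The cut-off on the cube only makes differences smaller, so the estimates on the line serve both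
domains. -/
theorem abs_domainDiff_le (G : Domain) (ℓ : ℕ) (t : ℝ) (v : ℝ → ℝ) (x : ℝ) :
    |domainDiff G ℓ t v x| ≤ |lineDiff ℓ t v x| := by
  cases G
  · simp only [domainDiff]
    split_ifs
    · exact le_rfl
    · simp
  · exact le_rfl

theorem prod_update_factor {d : ℕ} (v : Fin d → ℝ → ℝ) (i : Fin d) (g : ℝ → ℝ)
    (x : Fin d → ℝ) :
    ∏ j, (if j = i then g else v j) (x j) = g (x i) * ∏ j ∈ Finset.univ.erase i, v j (x j) := by
  rw [← Finset.mul_prod_erase _ _ (Finset.mem_univ i), if_pos rfl]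
  congr 1
  refine Finset.prod_congr rfl fun j hj => ?_
  rw [if_neg (Finset.ne_of_mem_erase hj)]

theorem diffSum_tensorSum {d : ℕ} (ℓ : ℕ) (i : Fin d) (t A : ℝ) (K : Finset (Fin d → ℕ))
    (v : (Fin d → ℕ) → Fin d → ℝ → ℝ) (x : Fin d → ℝ) :
    diffSum ℓ i t (tensorSum A K v) x =
      tensorSum A K (fun k j => if j = i then lineDiff ℓ t (v k i) else v k j) x := by
  have hupd : ∀ (k : Fin d → ℕ) (y : ℝ), ∏ j, v k j (Function.update x i y j) =
      v k i y * ∏ j ∈ Finset.univ.erase i, v k j (x j) := fun k y => by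
    rw [← Finset.mul_prod_erase _ _ (Finset.mem_univ i), Function.update_self]
    congr 1
    refine Finset.prod_congr rfl fun j hj => ?_
    rw [Function.update_of_ne (Finset.ne_of_mem_erase hj)]
  simp only [diffSum, tensorSum, hupd, prod_update_factor]
  have : (∑ k ∈ K, A * (lineDiff ℓ t (v k i) (x i) * ∏ j ∈ Finset.univ.erase i, v k j (x j))) =
      ∑ n ∈ Finset.range (ℓ + 1), (-1 : ℝ) ^ (ℓ - n) * (ℓ.choose n : ℝ) *
        ∑ k ∈ K, A * (v k i (x i + n * t) * ∏ j ∈ Finset.univ.erase i, v k j (x j)) := by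
    simp only [lineDiff, Finset.mul_sum, Finset.sum_mul]
    rw [Finset.sum_comm]
    refine Finset.sum_congr rfl fun n _ => Finset.sum_congr rfl fun k _ => ?_
    ring
  rw [this]
  push_cast
  rfl

theorem diff_tensorSum {d : ℕ} (G : Domain) (ℓ : ℕ) (i : Fin d) (t A : ℝ)
    (K : Finset (Fin d → ℕ)) (v : (Fin d → ℕ) → Fin d → ℝ → ℝ) :
    diff G ℓ i t (tensorSum A K v) =
      tensorSum A K (fun k j => if j = i then domainDiff G ℓ t (v k i) else v k j) := by
  ext x
  cases G
  · simp only [diff]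
    split_ifs with hx
    · rw [diffSum_tensorSum]
      simp only [tensorSum, prod_update_factor, domainDiff, if_pos hx]
    · simp only [tensorSum, prod_update_factor, domainDiff, if_neg hx]
      simp
  · exact diffSum_tensorSum ℓ i t A K v x

theorem mixedDiff_tensorSum {d : ℕ} (G : Domain) (ℓ : ℕ) (e : Finset (Fin d)) (h : Fin d → ℝ)
    (A : ℝ) (K : Finset (Fin d → ℕ)) (v : (Fin d → ℕ) → Fin d → ℝ → ℝ) :
    mixedDiff G ℓ e h (tensorSum A K v) =
      tensorSum A K (fun k j => if j ∈ e then domainDiff G ℓ (h j) (v k j) else v k j) := by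
  -- Absence of repetitions guarantees that each variable is differenced only once.
  have key : ∀ l : List (Fin d), l.Nodup →
      l.foldr (fun i g => if i ∈ e then diff G ℓ i (h i) g else g) (tensorSum A K v) =
        tensorSum A K
          (fun k j => if j ∈ e ∧ j ∈ l then domainDiff G ℓ (h j) (v k j) else v k j) := by
    intro l
    induction l with
    | nil => simp
    | cons a l ih =>
      intro hl
      rw [List.nodup_cons] at hl
      rw [List.foldr_cons, ih hl.2]
      split_ifs with ha
      · rw [diff_tensorSum]
        congr 1
        ext k j : 2
        by_cases hj : j = a
        · subst hj
          simp [ha, hl.1]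
        · simp [hj]
      · congr 1
        ext k j : 2
        by_cases hj : j = a
        · subst hj
          simp [ha]
        · simp [hj]
  rw [mixedDiff, key _ (List.nodup_finRange d)]
  simp

/-! ### The Besov norm of sums of tensor products of atoms -/

/-- Setting `t = 1` in the variables outside `e` makes the minimum equal to `1`, so differenced and
untouched factors obey one and the same bound. -/
theorem IsAtomFamily.exists_support {ℓ : ℕ} {p : ℝ≥0∞} {η C : ℝ} {u : ℕ → ℝ → ℝ}
    (hu : IsAtomFamily ℓ p η C u) (hC : 1 ≤ C) (G : Domain) (e : Prop) [Decidable e] (κ : ℕ)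
    (h t : ℝ) (ht : e → |h| < t) (ht1 : ¬ e → t = 1) :
    ∃ S, MeasurableSet S ∧
      volume (S ∩ Set.Icc 0 1) ^ (1 / p.toReal) ≤ ENNReal.ofReal (C * 2 ^ (-(η * κ))) ∧
      ∀ x, |(if e then domainDiff G ℓ h (u κ) else u κ) x| ≤
        S.indicator (fun _ => C * min 1 ((2 ^ κ * t) ^ ℓ)) x := by
  by_cases he : e
  · obtain ⟨S, hS, hV, hb⟩ := hu.diff_le κ h
    refine ⟨S, hS, hV, fun x => ?_⟩
    rw [if_pos he]
    refine (abs_domainDiff_le _ _ _ _ _).trans ((hb x).trans ?_)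
    refine Set.indicator_le_indicator ?_
    have := (ht he).le
    gcongr
  · obtain ⟨S, hS, hV, hb⟩ := hu.measure_le κ
    refine ⟨S, hS, hV, fun x => ?_⟩
    rw [if_neg he]
    refine (hb x).trans (Set.indicator_le_indicator ?_)
    rw [ht1 he, mul_one, min_eq_left (one_le_pow₀ (one_le_pow₀ (by norm_num))), mul_one]

/-- Each summand is dominated by a constant on a box, whose volume factorises. One factor `C` per
variable comes from the height and one from the measure of the support, giving `C ^ 2`. -/
theorem modulus_rpow_le {d ℓ : ℕ} {p : ℝ≥0∞} {η C : ℝ} {u : ℕ → ℝ → ℝ}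
    (hu : IsAtomFamily ℓ p η C u) (hC : 1 ≤ C) (G : Domain) (e : Finset (Fin d)) {A : ℝ}
    (hA : 0 ≤ A) (K : Finset (Fin d → ℕ)) (t : Fin d → ℝ) (ht0 : ∀ i, 0 < t i)
    (ht1 : ∀ i ∉ e, t i = 1)
    {r : ℝ} (hr : 0 < r) (hr1 : r ≤ 1) (hrp : ENNReal.ofReal r ≤ p) :
    modulus G ℓ e (tensorSum A K fun k i => u (k i)) t p ≤
      (∑ k ∈ K, ENNReal.ofReal
        (A * ∏ i, (C ^ 2 * 2 ^ (-(η * k i)) * min 1 ((2 ^ k i * t i) ^ ℓ))) ^ r) ^ (1 / r) := by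
  refine iSup₂_le fun h hh => ?_
  rw [one_div, ENNReal.le_rpow_inv_iff hr, mixedDiff_tensorSum]
  have hex : ∀ (k : Fin d → ℕ) (i : Fin d), _ := fun k i =>
    hu.exists_support hC G (i ∈ e) (k i) (h i) (t i) (hh i) (ht1 i)
  choose S hS hV hb using hex
  have hc : ∀ k : Fin d → ℕ, 0 ≤ A * ∏ i, (C * min 1 ((2 ^ k i * t i) ^ ℓ)) := fun k =>
    mul_nonneg hA (Finset.prod_nonneg fun i _ =>
      mul_nonneg (by linarith) (le_min zero_le_one (by have := ht0 i; positivity)))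
  refine (lpQuasiNorm_rpow_le K (R := fun k => Set.univ.pi (S k)) (fun k _ => hc k)
    (fun k _ => MeasurableSet.univ_pi (hS k)) (fun x => ?_) hr hr1 hrp).trans ?_
  · rw [tensorSum, Complex.norm_real, Real.norm_eq_abs]
    refine (Finset.abs_sum_le_sum_abs _ _).trans (Finset.sum_le_sum fun k _ => ?_)
    rw [abs_mul, abs_of_nonneg hA, Finset.abs_prod]
    by_cases hx : x ∈ Set.univ.pi (S k)
    · rw [Set.indicator_of_mem hx]
      refine mul_le_mul_of_nonneg_left ?_ hA
      refine Finset.prod_le_prod (fun i _ => abs_nonneg _) fun i _ => ?_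
      have := hb k i (x i)
      rwa [Set.indicator_of_mem (hx i (Set.mem_univ i))] at this
    · rw [Set.indicator_of_notMem hx]
      simp only [Set.mem_univ_pi, not_forall] at hx
      obtain ⟨i, hi⟩ := hx
      have := hb k i (x i)
      rw [Set.indicator_of_notMem hi] at this
      rw [Finset.prod_eq_zero (Finset.mem_univ i) (le_antisymm this (abs_nonneg _)), mul_zero]
  · refine Finset.sum_le_sum fun k _ => ENNReal.rpow_le_rpow ?_ hr.le
    rw [volume_pi_inter_unitCube, ← ENNReal.prod_rpow_of_nonneg (by positivity)]
    refine (mul_le_mul_right (Finset.prod_le_prod' fun i _ => hV k i) _).trans (le_of_eq ?_)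
    rw [← ENNReal.ofReal_prod_of_nonneg fun i _ => by positivity, ← ENNReal.ofReal_mul (hc k),
      mul_assoc, ← Finset.prod_mul_distrib]
    congr 2
    refine Finset.prod_congr rfl fun i _ => ?_
    ring

theorem weighted_prod_rpow_le {d ℓ m : ℕ} {α η r A C : ℝ} (hα : 0 < α) (hαℓ : α < ℓ) (hr : 0 < r)
    (hA : 0 ≤ A) (hC : 1 ≤ C) (k : Fin d → ℕ) (hk : ∑ i, k i = m) (t : Fin d → ℝ)
    (ht : ∀ i, 0 < t i) :
    ((∏ i, t i ^ (-α)) *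
        (A * ∏ i, (C ^ 2 * 2 ^ (-(η * k i)) * min 1 ((2 ^ k i * t i) ^ ℓ)))) ^ r ≤
      (A * (C ^ 2) ^ d * 2 ^ ((α - η) * m)) ^ r *
        ∏ i, weight (r * min α (ℓ - α)) (k i) (t i) := by
  have hsum : (∑ i, (k i : ℝ)) = m := by exact_mod_cast hk
  have hpow : ∀ a : ℝ, ∏ i, (2 : ℝ) ^ (a * k i) = 2 ^ (a * m) := fun a => by
    rw [← Real.rpow_sum_of_pos (by norm_num), ← Finset.mul_sum, hsum]
  have hX : ∀ i, 0 ≤ t i ^ (-α) * min 1 ((2 ^ k i * t i) ^ ℓ) := fun i => by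
    have := ht i
    positivity
  have h1 : (∏ i, t i ^ (-α)) *
      (A * ∏ i, (C ^ 2 * 2 ^ (-(η * k i)) * min 1 ((2 ^ k i * t i) ^ ℓ))) =
      (A * (C ^ 2) ^ d * 2 ^ (-η * m)) * ∏ i, (t i ^ (-α) * min 1 ((2 ^ k i * t i) ^ ℓ)) := by
    rw [← hpow, Finset.prod_mul_distrib, Finset.prod_mul_distrib, Finset.prod_mul_distrib,
      Finset.prod_const, Finset.card_univ, Fintype.card_fin]
    simp only [neg_mul]
    ring
  have h2 : (A * (C ^ 2) ^ d * (2 : ℝ) ^ ((α - η) * m)) ^ r =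
      (A * (C ^ 2) ^ d * 2 ^ (-η * m)) ^ r * 2 ^ (α * r * m) := by
    have : (2 : ℝ) ^ (α * r * m) = (2 ^ (α * m)) ^ r := by
      rw [← Real.rpow_mul (by norm_num)]
      ring_nf
    rw [this, ← Real.mul_rpow (by positivity) (by positivity), mul_assoc _ ((2 : ℝ) ^ (-η * m)),
      ← Real.rpow_add (by norm_num)]
    ring_nf
  rw [h1, h2, Real.mul_rpow (by positivity) (Finset.prod_nonneg fun i _ => hX i), mul_assoc (_ ^ r),
    ← Real.finsetProd_rpow _ _ fun i _ => hX i, ← hpow (α * r),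
    ← Finset.prod_mul_distrib]
  refine mul_le_mul_of_nonneg_left ?_ (by positivity)
  exact Finset.prod_le_prod (fun i _ => Real.rpow_nonneg (hX i) _) fun i _ =>
    rpow_smoothness_le_weight hr hα hαℓ (k i) (ht i)

theorem weightedModulus_tensorSum_le {d ℓ m : ℕ} {p : ℝ≥0∞} {α η C : ℝ} {u : ℕ → ℝ → ℝ}
    (hu : IsAtomFamily ℓ p η C u) (hC : 1 ≤ C) (hα : 0 < α) (hαℓ : α < ℓ) (G : Domain)
    (e : Finset (Fin d)) {A : ℝ} (hA : 0 ≤ A) (K : Finset (Fin d → ℕ))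
    (hK : ∀ k ∈ K, ∑ i, k i = m) {r : ℝ} (hr : 0 < r) (hr1 : r ≤ 1)
    (hrp : ENNReal.ofReal r ≤ p) (t : Fin d → ℝ) (ht : ∀ i, 0 < t i) :
    weightedModulus G ℓ α e (tensorSum A K fun k i => u (k i)) t p ≤
      ENNReal.ofReal (A * (C ^ 2) ^ d * 2 ^ ((α - η) * m)) *
        (∑ k ∈ K, ∏ i, ENNReal.ofReal
          (weight (r * min α (ℓ - α)) (k i) (if i ∈ e then t i else 1))) ^ (1 / r) := by
  set s : Fin d → ℝ := fun i => if i ∈ e then t i else 1 with hs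
  have hs0 : ∀ i, 0 < s i := fun i => by
    simp only [hs]
    split_ifs
    exacts [ht i, one_pos]
  have hmod : modulus G ℓ e (tensorSum A K fun k i => u (k i)) t p =
      modulus G ℓ e (tensorSum A K fun k i => u (k i)) s p := by
    unfold modulus
    refine iSup_congr fun h => iSup_congr_Prop ?_ fun _ => rfl
    refine forall₂_congr fun i hi => ?_
    simp [hs, hi]
  have hprod : ∏ i ∈ e, ENNReal.ofReal (t i) ^ (-α) = ENNReal.ofReal (∏ i, s i ^ (-α)) := by
    rw [ENNReal.ofReal_prod_of_nonneg fun i _ => Real.rpow_nonneg (hs0 i).le _]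
    simp only [← ENNReal.ofReal_rpow_of_pos (hs0 _)]
    rw [← Finset.prod_subset (Finset.subset_univ e)]
    · refine Finset.prod_congr rfl fun i hi => ?_
      simp [hs, hi]
    · intro i _ hi
      simp [hs, hi]
  have hL : 0 ≤ A * (C ^ 2) ^ d * (2 : ℝ) ^ ((α - η) * m) := by positivity
  have hP : 0 ≤ ∏ i, s i ^ (-α) := Finset.prod_nonneg fun i _ => Real.rpow_nonneg (hs0 i).le _
  rw [weightedModulus, hmod, hprod]
  refine (mul_le_mul_right (modulus_rpow_le hu hC G e hA K s hs0 (fun i hi => by simp [hs, hi])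
    hr hr1 hrp) _).trans ?_
  rw [one_div, ← ENNReal.rpow_le_rpow_iff hr, ENNReal.mul_rpow_of_nonneg _ _ hr.le,
    ENNReal.mul_rpow_of_nonneg _ _ hr.le, ENNReal.rpow_inv_rpow hr.ne', ENNReal.rpow_inv_rpow hr.ne',
    Finset.mul_sum, Finset.mul_sum]
  refine Finset.sum_le_sum fun k hk => ?_
  have hM : 0 ≤ A * ∏ i, (C ^ 2 * 2 ^ (-(η * k i)) * min 1 ((2 ^ k i * s i) ^ ℓ)) :=
    mul_nonneg hA (Finset.prod_nonneg fun i _ => by have := hs0 i; positivity)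
  rw [← ENNReal.mul_rpow_of_nonneg _ _ hr.le, ← ENNReal.ofReal_mul hP,
    ENNReal.ofReal_rpow_of_nonneg (mul_nonneg hP hM) hr.le, ENNReal.ofReal_rpow_of_nonneg hL hr.le,
    ← ENNReal.ofReal_prod_of_nonneg fun i _ => weight_nonneg _ (hs0 i).le,
    ← ENNReal.ofReal_mul (Real.rpow_nonneg hL _)]
  exact ENNReal.ofReal_le_ofReal (weighted_prod_rpow_le hα hαℓ hr hA hC k (hK k hk) s hs0)

/-- Enlarging `K` to a full box of levels turns the sum of products into a product of sums; the
resulting bound is independent of `m` and `K`. -/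
theorem sum_prod_weight_le {d m : ℕ} {ε : ℝ} (hε : 0 < ε) (K : Finset (Fin d → ℕ))
    (hK : ∀ k ∈ K, ∑ i, k i = m) (s : Fin d → ℝ) (hs0 : ∀ i, 0 < s i) (hs1 : ∀ i, s i ≤ 1) :
    ∑ k ∈ K, ∏ i, ENNReal.ofReal (weight ε (k i) (s i)) ≤
      ENNReal.ofReal (2 * (1 - (2 : ℝ) ^ (-ε))⁻¹) ^ d := by
  have hsub : K ⊆ Fintype.piFinset fun _ : Fin d => Finset.range (m + 1) := by
    intro k hk
    rw [Fintype.mem_piFinset]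
    intro i
    rw [Finset.mem_range, Nat.lt_succ_iff, ← hK k hk]
    exact Finset.single_le_sum (f := k) (fun _ _ => Nat.zero_le _) (Finset.mem_univ i)
  refine (Finset.sum_le_sum_of_subset hsub).trans ?_
  rw [← Finset.prod_univ_sum (fun _ : Fin d => Finset.range (m + 1))
    fun i κ => ENNReal.ofReal (weight ε κ (s i))]
  refine (Finset.prod_le_prod' (g := fun _ => ENNReal.ofReal (2 * (1 - (2 : ℝ) ^ (-ε))⁻¹))
    fun i _ => ?_).trans (by simp)
  rw [← ENNReal.ofReal_sum_of_nonneg fun κ _ => weight_nonneg κ (hs0 i).le]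
  exact ENNReal.ofReal_le_ofReal (sum_weight_le hε (hs0 i) (hs1 i) _)

/-- Tonelli, term by term: a variable in `e` contributes at most `2 / ε`, any other at most `1`. -/
theorem lintegral_sum_prod_weight_le {d : ℕ} {ε : ℝ} (hε : 0 < ε) (e : Finset (Fin d))
    (K : Finset (Fin d → ℕ)) :
    ∫⁻ t in Set.univ.pi fun _ : Fin d => Set.Ioc (0 : ℝ) 1,
        (∑ k ∈ K, ∏ i, ENNReal.ofReal (weight ε (k i) (if i ∈ e then t i else 1))) *
          ∏ i ∈ e, (ENNReal.ofReal (t i))⁻¹ ≤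
      K.card * ENNReal.ofReal (max 1 (2 / ε)) ^ d := by
  set g : (Fin d → ℕ) → Fin d → ℝ → ℝ≥0∞ := fun k i τ =>
    if i ∈ e then ENNReal.ofReal (weight ε (k i) τ * τ⁻¹) else ENNReal.ofReal (weight ε (k i) 1)
    with hg
  have hgm : ∀ k i, Measurable (g k i) := fun k i => by
    simp only [hg]
    split_ifs
    · exact ((measurable_weight ε (k i)).mul measurable_inv).ennreal_ofReal
    · exact measurable_const
  have hmeas : MeasurableSet (Set.univ.pi fun _ : Fin d => Set.Ioc (0 : ℝ) 1) :=
    MeasurableSet.univ_pi fun _ => measurableSet_Ioc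
  have h1 : ∫⁻ t in Set.univ.pi fun _ : Fin d => Set.Ioc (0 : ℝ) 1,
        (∑ k ∈ K, ∏ i, ENNReal.ofReal (weight ε (k i) (if i ∈ e then t i else 1))) *
          ∏ i ∈ e, (ENNReal.ofReal (t i))⁻¹ =
      ∫⁻ t in Set.univ.pi fun _ : Fin d => Set.Ioc (0 : ℝ) 1, ∑ k ∈ K, ∏ i, g k i (t i) := by
    refine setLIntegral_congr_fun hmeas fun t ht => ?_
    rw [Finset.sum_mul]
    refine Finset.sum_congr rfl fun k _ => ?_
    have : ∏ i ∈ e, (ENNReal.ofReal (t i))⁻¹ =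
        ∏ i, if i ∈ e then (ENNReal.ofReal (t i))⁻¹ else 1 := by simp
    rw [this, ← Finset.prod_mul_distrib]
    refine Finset.prod_congr rfl fun i _ => ?_
    have hti : 0 < t i := (ht i (Set.mem_univ i)).1
    simp only [hg]
    split_ifs
    · rw [ENNReal.ofReal_mul (weight_nonneg _ hti.le), ENNReal.ofReal_inv_of_pos hti]
    · rw [mul_one]
  have hgp : ∀ k ∈ K, Measurable fun t : Fin d → ℝ => ∏ i, g k i (t i) := fun k _ =>
    Finset.measurable_prod _ fun i _ => (hgm k i).comp (measurable_pi_apply i)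
  rw [h1, lintegral_finsetSum _ hgp,
    ← nsmul_eq_mul, ← Finset.sum_const]
  refine Finset.sum_le_sum fun k _ => ?_
  rw [volume_pi, Measure.restrict_pi_pi, lintegral_pi_prod _ (hgm k)]
  refine (Finset.prod_le_prod' (g := fun _ => ENNReal.ofReal (max 1 (2 / ε)))
    fun i _ => ?_).trans (by simp)
  simp only [hg]
  split_ifs
  · exact (lintegral_weight_le hε (k i)).trans (ENNReal.ofReal_le_ofReal (le_max_right _ _))
  · rw [lintegral_const]
    simp only [MeasurableSet.univ, Measure.restrict_apply, Set.univ_inter, Real.volume_Ioc,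
      sub_zero, ENNReal.ofReal_one, mul_one]
    exact ENNReal.ofReal_le_ofReal ((weight_le_one hε.le _ one_pos).trans (le_max_left _ _))

/-- The weighted modulus is at most a constant times `W^{1/r}`, where `W` is the sum of product
weights. `W` is bounded uniformly and its integral is of order `|K|`, so `∫ W^{θ/r}` is of order
`|K|`; this is the source of the power `|K|^{1/θ}`. -/
theorem exists_besovSeminorm_tensorSum_le {d ℓ : ℕ} {p θ : ℝ≥0∞} {α η C : ℝ} {u : ℕ → ℝ → ℝ}
    (hp : 0 < p) (hθ : 0 < θ) (hu : IsAtomFamily ℓ p η C u) (hC : 1 ≤ C) (hα : 0 < α)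
    (hαℓ : α < ℓ) (G : Domain) :
    ∃ D : ℝ≥0∞, D ≠ ∞ ∧ ∀ (e : Finset (Fin d)) (A : ℝ) (m : ℕ) (K : Finset (Fin d → ℕ)), 0 ≤ A →
      (∀ k ∈ K, ∑ i, k i = m) →
      besovSeminorm G ℓ α p θ e (tensorSum A K fun k i => u (k i)) ≤
        D * ENNReal.ofReal (A * 2 ^ ((α - η) * m)) * (K.card : ℝ≥0∞) ^ (θ⁻¹).toReal := by
  -- Here `r = min(1, p, θ)`: `r ≤ min(1, p)` serves the `r`-triangle inequality, and `r ≤ θ` makes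
  -- `θ/r - 1` nonnegative.
  obtain ⟨r, hr, hr1, hrp, hrθ⟩ : ∃ r : ℝ, 0 < r ∧ r ≤ 1 ∧ ENNReal.ofReal r ≤ p ∧
      ENNReal.ofReal r ≤ θ := by
    have hmin : 0 < min 1 (min p θ) := lt_min one_pos (lt_min hp hθ)
    have hfin : min 1 (min p θ) ≠ ∞ := ((min_le_left _ _).trans_lt ENNReal.one_lt_top).ne
    refine ⟨(min 1 (min p θ)).toReal, ENNReal.toReal_pos hmin.ne' hfin, ?_, ?_, ?_⟩
    · simpa using ENNReal.toReal_mono ENNReal.one_ne_top (min_le_left 1 (min p θ))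
    · rw [ENNReal.ofReal_toReal hfin]
      exact (min_le_right _ _).trans (min_le_left _ _)
    · rw [ENNReal.ofReal_toReal hfin]
      exact (min_le_right _ _).trans (min_le_right _ _)
  set ε := r * min α (ℓ - α) with hεdef
  have hε : 0 < ε := mul_pos hr (lt_min hα (by linarith))
  set S := ENNReal.ofReal (2 * (1 - (2 : ℝ) ^ (-ε))⁻¹) ^ d with hS
  have hSfin : S ≠ ∞ := ENNReal.pow_ne_top ENNReal.ofReal_ne_top
  set E := ENNReal.ofReal (max 1 (2 / ε)) ^ d with hE
  have hEfin : E ≠ ∞ := ENNReal.pow_ne_top ENNReal.ofReal_ne_top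
  have hLeq : ∀ A : ℝ, ∀ m : ℕ, ENNReal.ofReal (A * (C ^ 2) ^ d * 2 ^ ((α - η) * m)) =
      ENNReal.ofReal ((C ^ 2) ^ d) * ENNReal.ofReal (A * 2 ^ ((α - η) * m)) := fun A m => by
    rw [← ENNReal.ofReal_mul (by positivity)]
    ring_nf
  have hone : ∀ (e : Finset (Fin d)) (t : Fin d → ℝ),
      t ∈ (Set.univ.pi fun _ : Fin d => Set.Ioc (0 : ℝ) 1) →
      (∀ i, 0 < if i ∈ e then t i else 1) ∧ ∀ i, (if i ∈ e then t i else 1) ≤ 1 := by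
    intro e t ht
    have := fun i => ht i (Set.mem_univ i)
    constructor <;> intro i <;> split_ifs
    exacts [(this i).1, one_pos, (this i).2, le_rfl]
  by_cases hθt : θ = ∞
  · refine ⟨ENNReal.ofReal ((C ^ 2) ^ d) * S ^ (1 / r), ENNReal.mul_ne_top ENNReal.ofReal_ne_top
      (ENNReal.rpow_ne_top_of_nonneg (by positivity) hSfin), fun e A m K hA hK => ?_⟩
    rw [besovSeminorm, if_pos hθt, hθt]
    simp only [ENNReal.inv_top, ENNReal.toReal_zero, ENNReal.rpow_zero, mul_one]
    refine iSup₂_le fun t ht => ?_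
    refine (weightedModulus_tensorSum_le hu hC hα hαℓ G e hA K hK hr hr1 hrp t
      fun i => (ht i (Set.mem_univ i)).1).trans ?_
    rw [hLeq, mul_right_comm]
    refine mul_le_mul_left (mul_le_mul_right (ENNReal.rpow_le_rpow ?_ (by positivity)) _) _
    exact sum_prod_weight_le hε K hK _ (hone e t ht).1 (hone e t ht).2
  · have hθ0 : 0 < θ.toReal := ENNReal.toReal_pos hθ.ne' hθt
    have hrθ' : r ≤ θ.toReal := (ENNReal.ofReal_le_iff_le_toReal hθt).1 hrθ
    have hexp : 0 ≤ θ.toReal / r - 1 := by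
      rw [sub_nonneg, le_div_iff₀ hr, one_mul]
      exact hrθ'
    refine ⟨ENNReal.ofReal ((C ^ 2) ^ d) * (S ^ (θ.toReal / r - 1) * E) ^ (1 / θ.toReal),
      ENNReal.mul_ne_top ENNReal.ofReal_ne_top (ENNReal.rpow_ne_top_of_nonneg (by positivity)
        (ENNReal.mul_ne_top (ENNReal.rpow_ne_top_of_nonneg hexp hSfin) hEfin)),
      fun e A m K hA hK => ?_⟩
    rw [besovSeminorm, if_neg hθt]
    set L := ENNReal.ofReal (A * (C ^ 2) ^ d * 2 ^ ((α - η) * m)) with hL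
    set W : (Fin d → ℝ) → ℝ≥0∞ := fun t =>
      ∑ k ∈ K, ∏ i, ENNReal.ofReal (weight ε (k i) (if i ∈ e then t i else 1)) with hW
    have hpt : ∀ t ∈ (Set.univ.pi fun _ : Fin d => Set.Ioc (0 : ℝ) 1),
        weightedModulus G ℓ α e (tensorSum A K fun k i => u (k i)) t p ^ θ.toReal *
            ∏ i ∈ e, (ENNReal.ofReal (t i))⁻¹ ≤
          L ^ θ.toReal * S ^ (θ.toReal / r - 1) * (W t * ∏ i ∈ e, (ENNReal.ofReal (t i))⁻¹) := by
      intro t ht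
      have h1 := weightedModulus_tensorSum_le hu hC hα hαℓ G e hA K hK hr hr1 hrp t
        fun i => (ht i (Set.mem_univ i)).1
      have h2 : W t ≤ S := sum_prod_weight_le hε K hK _ (hone e t ht).1 (hone e t ht).2
      rw [← mul_assoc]
      refine mul_le_mul_left ?_ _
      refine (ENNReal.rpow_le_rpow h1 hθ0.le).trans ?_
      change (L * W t ^ (1 / r)) ^ θ.toReal ≤ _
      rw [ENNReal.mul_rpow_of_nonneg _ _ hθ0.le, ← ENNReal.rpow_mul, mul_assoc]
      refine mul_le_mul_right ?_ _
      -- One power of `W` is kept for the integration, the others are replaced by the uniform bound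
      -- `S`.
      have : 1 / r * θ.toReal = (θ.toReal / r - 1) + 1 := by ring
      rw [this, ENNReal.rpow_add_of_nonneg _ _ hexp zero_le_one, ENNReal.rpow_one]
      exact mul_le_mul_left (ENNReal.rpow_le_rpow h2 hexp) _
    have hmeas : MeasurableSet (Set.univ.pi fun _ : Fin d => Set.Ioc (0 : ℝ) 1) :=
      MeasurableSet.univ_pi fun _ => measurableSet_Ioc
    have hfin : L ^ θ.toReal * S ^ (θ.toReal / r - 1) ≠ ∞ :=
      ENNReal.mul_ne_top (ENNReal.rpow_ne_top_of_nonneg hθ0.le ENNReal.ofReal_ne_top)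
        (ENNReal.rpow_ne_top_of_nonneg hexp hSfin)
    refine (ENNReal.rpow_le_rpow (setLIntegral_mono' hmeas hpt) (by positivity)).trans ?_
    rw [lintegral_const_mul' _ _ hfin]
    refine (ENNReal.rpow_le_rpow (mul_le_mul_right (lintegral_sum_prod_weight_le hε e K) _)
      (by positivity)).trans (le_of_eq ?_)
    have hθi : (0 : ℝ) ≤ 1 / θ.toReal := by positivity
    have hinv : (θ⁻¹).toReal = 1 / θ.toReal := by rw [ENNReal.toReal_inv, one_div]
    rw [hinv, ENNReal.mul_rpow_of_nonneg _ _ hθi, ENNReal.mul_rpow_of_nonneg _ _ hθi,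
      ENNReal.mul_rpow_of_nonneg _ _ hθi, ENNReal.mul_rpow_of_nonneg _ _ hθi, ← ENNReal.rpow_mul,
      mul_one_div_cancel hθ0.ne', ENNReal.rpow_one, hL, hLeq]
    ring

theorem exists_besovNorm_tensorSum_le {d ℓ : ℕ} {p θ : ℝ≥0∞} {α η C : ℝ} {u : ℕ → ℝ → ℝ}
    (hp : 0 < p) (hθ : 0 < θ) (hu : IsAtomFamily ℓ p η C u) (hC : 1 ≤ C) (hα : 0 < α)
    (hαℓ : α < ℓ) (G : Domain) :
    ∃ D : ℝ, 0 < D ∧ ∀ (A : ℝ) (m : ℕ) (K : Finset (Fin d → ℕ)), 0 ≤ A →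
      (∀ k ∈ K, ∑ i, k i = m) →
      besovNorm G ℓ α p θ (tensorSum A K fun k i => u (k i)) ≤
        ENNReal.ofReal (D * A * 2 ^ ((α - η) * m) * (K.card : ℝ) ^ (θ⁻¹).toReal) := by
  obtain ⟨D, hD, h⟩ := exists_besovSeminorm_tensorSum_le (d := d) hp hθ hu hC hα hαℓ G
  -- The factor `2 ^ d` counts the sets `e`; adding `1` makes the constant positive.
  refine ⟨2 ^ d * (D.toReal + 1), by positivity, fun A m K hA hK => ?_⟩
  rw [besovNorm]
  refine (Finset.sum_le_sum fun e _ => h e A m K hA hK).trans ?_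
  rw [Finset.sum_const, Finset.card_univ, Fintype.card_finset, Fintype.card_fin, nsmul_eq_mul]
  have hcard : (K.card : ℝ≥0∞) ^ (θ⁻¹).toReal = ENNReal.ofReal ((K.card : ℝ) ^ (θ⁻¹).toReal) := by
    rw [← ENNReal.ofReal_rpow_of_nonneg (by positivity) ENNReal.toReal_nonneg,
      ENNReal.ofReal_natCast]
  rw [hcard]
  have h2 : ENNReal.ofReal (2 ^ d * (D.toReal + 1) * A * 2 ^ ((α - η) * m) *
      (K.card : ℝ) ^ (θ⁻¹).toReal) = ((2 ^ d : ℕ) : ℝ≥0∞) * (ENNReal.ofReal (D.toReal + 1) *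
        ENNReal.ofReal (A * 2 ^ ((α - η) * m)) * ENNReal.ofReal ((K.card : ℝ) ^ (θ⁻¹).toReal)) := by
    rw [← ENNReal.ofReal_natCast, ← ENNReal.ofReal_mul (by positivity),
      ← ENNReal.ofReal_mul (by positivity), ← ENNReal.ofReal_mul (by positivity)]
    push_cast
    ring_nf
  rw [h2]
  gcongr
  rw [← ENNReal.ofReal_toReal hD]
  refine ENNReal.ofReal_le_ofReal ?_
  rw [ENNReal.toReal_ofReal ENNReal.toReal_nonneg]
  linarith

/-! ### Cardinalities -/

theorem card_nodes (k : ℕ) : (nodes k).card = 2 ^ k := by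
  rw [nodes, Finset.card_image_of_injective, Finset.card_range]
  intro a b hab
  have h2 : (2 : ℝ) ^ k ≠ 0 := by positivity
  have : (a : ℝ) = b := by
    field_simp at hab
    exact hab
  exact_mod_cast this

theorem nodes_mono : Monotone nodes := by
  refine monotone_nat_of_le_succ fun k x hx => ?_
  obtain ⟨l, hl, rfl⟩ := Finset.mem_image.1 hx
  refine Finset.mem_image.2 ⟨2 * l, ?_, ?_⟩
  · rw [Finset.mem_range] at hl ⊢
    rw [pow_succ]
    omega
  · push_cast
    rw [pow_succ]
    field_simp

/-- The nodes of level exactly `k`. -/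
def newNodes (k : ℕ) : Finset ℝ := nodes k \ (Finset.range k).biUnion nodes

theorem two_pow_le_two_mul_card_newNodes (k : ℕ) : 2 ^ k ≤ 2 * (newNodes k).card := by
  cases k with
  | zero => simp [newNodes, card_nodes]
  | succ k =>
    have hsub : (Finset.range (k + 1)).biUnion nodes ⊆ nodes k :=
      Finset.biUnion_subset.2 fun j hj =>
        nodes_mono (Nat.lt_succ_iff.1 (Finset.mem_range.1 hj))
    have h1 : (nodes (k + 1)).card - (nodes k).card ≤ (newNodes (k + 1)).card :=
      (Finset.le_card_sdiff _ _).trans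
        (Finset.card_le_card (Finset.sdiff_subset_sdiff le_rfl hsub))
    rw [card_nodes, card_nodes, pow_succ] at h1
    rw [pow_succ]
    omega

theorem disjoint_newNodes {j k : ℕ} (h : j ≠ k) : Disjoint (newNodes j) (newNodes k) := by
  have key : ∀ {a b : ℕ}, a < b → Disjoint (newNodes a) (newNodes b) := fun {a b} hab => by
    refine Finset.disjoint_left.2 fun x hx hx' => ?_
    exact (Finset.mem_sdiff.1 hx').2
      (Finset.mem_biUnion.2 ⟨a, Finset.mem_range.2 hab, (Finset.mem_sdiff.1 hx).1⟩)
  rcases lt_or_gt_of_ne h with h | h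
  · exact key h
  · exact (key h).symm

/-- The levels `k` with `k_1 + ⋯ + k_d = m`. -/
def levels (d m : ℕ) : Finset (Fin d → ℕ) := Finset.piAntidiag Finset.univ m

theorem mem_levels {d m : ℕ} {k : Fin d → ℕ} : k ∈ levels d m ↔ ∑ i, k i = m := by
  simp [levels]

/-- Products of new nodes are disjoint for different levels, and each variable loses at most a
factor `2` in passing from nodes to new nodes. -/
theorem levels_mul_two_pow_le_card (d m : ℕ) :
    (levels d m).card * 2 ^ m ≤ 2 ^ d * (smolyakGrid d m).card := by
  have hsub : ((levels d m).biUnion fun k => Fintype.piFinset fun i => newNodes (k i)) ⊆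
      smolyakGrid d m := by
    refine Finset.biUnion_subset.2 fun k hk x hx => mem_smolyakGrid.2 ⟨k, (mem_levels.1 hk).le,
      fun i => ?_⟩
    exact (Finset.mem_sdiff.1 (Fintype.mem_piFinset.1 hx i)).1
  refine le_trans ?_ (Nat.mul_le_mul_left _ (Finset.card_le_card hsub))
  rw [Finset.card_biUnion, Finset.mul_sum, ← smul_eq_mul, ← Finset.sum_const]
  · refine Finset.sum_le_sum fun k hk => ?_
    rw [Fintype.card_piFinset, ← mem_levels.1 hk, ← Finset.prod_pow_eq_pow_sum]
    have : (2 : ℕ) ^ d = ∏ _i : Fin d, 2 := by simp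
    rw [this, ← Finset.prod_mul_distrib]
    exact Finset.prod_le_prod' fun i _ => two_pow_le_two_mul_card_newNodes (k i)
  · intro k _ k' _ hne
    obtain ⟨i, hi⟩ := Function.ne_iff.1 hne
    refine Finset.disjoint_left.2 fun x hx hx' => ?_
    exact Finset.disjoint_left.1 (disjoint_newNodes hi) (Fintype.mem_piFinset.1 hx i)
      (Fintype.mem_piFinset.1 hx' i)

/-- Let `d - 1` coordinates range freely over `0, …, ⌊m/d⌋`; the remaining one is then determined
and nonnegative. -/
theorem pow_le_card_levels {d : ℕ} (hd : 1 ≤ d) (m : ℕ) :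
    (m + 1) ^ (d - 1) ≤ d ^ (d - 1) * (levels d m).card := by
  obtain ⟨n, rfl⟩ := Nat.exists_eq_add_of_le' hd
  rw [Nat.add_sub_cancel]
  have hle : m + 1 ≤ (n + 1) * (m / (n + 1) + 1) := by
    have := Nat.div_add_mod m (n + 1)
    have : m % (n + 1) < n + 1 := Nat.mod_lt m (Nat.succ_pos n)
    rw [mul_add]
    omega
  refine (Nat.pow_le_pow_left hle n).trans ?_
  rw [mul_pow]
  refine Nat.mul_le_mul_left _ ?_
  have hcard : (Fintype.piFinset fun _ : Fin n => Finset.range (m / (n + 1) + 1)).card =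
      (m / (n + 1) + 1) ^ n := by simp
  rw [← hcard]
  refine Finset.card_le_card_of_injOn
    (fun g => (Fin.cons (m - ∑ i, g i) g : Fin (n + 1) → ℕ)) (fun g hg => ?_) ?_
  · have hg' : ∑ i, g i ≤ m := by
      refine (Finset.sum_le_sum (g := fun _ => m / (n + 1)) fun i _ => ?_).trans ?_
      · exact Nat.lt_succ_iff.1 (Finset.mem_range.1 (Fintype.mem_piFinset.1 hg i))
      · rw [Finset.sum_const, Finset.card_univ, Fintype.card_fin, smul_eq_mul]
        exact (Nat.mul_le_mul_right _ (Nat.le_succ n)).trans (Nat.mul_div_le m (n + 1))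
    refine Finset.mem_coe.2 (mem_levels.2 ?_)
    rw [Fin.sum_univ_succ]
    simp only [Fin.cons_zero, Fin.cons_succ]
    omega
  · intro g _ g' _ h
    exact (Fin.cons_inj.1 h).2

/-! ### Functions vanishing on the grid -/

theorem tensorSum_eq_zero {d ℓ m m' : ℕ} (hd : 1 ≤ d) {p : ℝ≥0∞} {η C A : ℝ} {u : ℕ → ℝ → ℝ}
    (hu : IsAtomFamily ℓ p η C u) (K : Finset (Fin d → ℕ)) (hK : ∀ k ∈ K, ∑ i, k i = m)
    (hm : m' ≤ m) {x : Fin d → ℝ} (hx : x ∈ smolyakGrid d m') :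
    tensorSum A K (fun k i => u (k i)) x = 0 := by
  obtain ⟨j, hj, hxj⟩ := mem_smolyakGrid.1 hx
  rw [tensorSum, Finset.sum_eq_zero, Complex.ofReal_zero]
  intro k hk
  obtain ⟨i, hi⟩ : ∃ i, j i ≤ k i := by
    by_contra! hlt
    have : ∑ i, k i < ∑ i, j i :=
      Finset.sum_lt_sum_of_nonempty ⟨⟨0, hd⟩, Finset.mem_univ _⟩ fun i _ => hlt i
    have := hK k hk
    omega
  rw [Finset.prod_eq_zero (Finset.mem_univ i) (hu.eq_zero (k i) (j i) (x i) hi (hxj i)), mul_zero]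

theorem continuous_tensorSum {d ℓ : ℕ} {p : ℝ≥0∞} {η C A : ℝ} {u : ℕ → ℝ → ℝ}
    (hu : IsAtomFamily ℓ p η C u) (K : Finset (Fin d → ℕ)) :
    Continuous (tensorSum A K fun k i => u (k i)) := by
  unfold tensorSum
  refine Complex.continuous_ofReal.comp ?_
  refine continuous_finsetSum _ fun k _ => continuous_const.mul ?_
  exact continuous_finsetProd _ fun i _ => (hu.continuous (k i)).comp (continuous_apply i)

theorem isContinuousOn_tensorSum {d ℓ : ℕ} {p : ℝ≥0∞} {η C A : ℝ} {u : ℕ → ℝ → ℝ}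
    (hu : IsAtomFamily ℓ p η C u) (K : Finset (Fin d → ℕ)) (G : Domain) :
    IsContinuousOn G (tensorSum A K fun k i => u (k i)) := by
  have hc := continuous_tensorSum (A := A) hu K
  cases G
  · exact hc.continuousOn
  · refine ⟨hc, fun i x => ?_⟩
    simp only [tensorSum]
    congr 1
    refine Finset.sum_congr rfl fun k _ => ?_
    congr 1
    refine Finset.prod_congr rfl fun j _ => ?_
    by_cases hj : j = i
    · subst hj
      simpa using hu.periodic (k j) (x j)
    · simp [hj]

theorem le_optimalRecovery {d n : ℕ} {F : Set ((Fin d → ℝ) → ℂ)} {q B : ℝ≥0∞}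
    (h : ∀ m, (smolyakGrid d m).card ≤ n →
      ∃ f ∈ F, (∀ x ∈ smolyakGrid d m, f x = 0) ∧ B ≤ lpQuasiNorm f q) :
    B ≤ optimalRecovery n F q := by
  refine le_iInf₂ fun m hm => le_iInf₂ fun Φ _ => ?_
  obtain ⟨f, hf, h0, hB⟩ := h m hm
  refine le_iSup₂_of_le f hf ?_
  have : samplingAlgorithm m Φ f = 0 := by
    ext x
    exact Finset.sum_eq_zero fun ξ hξ => by rw [h0 ξ hξ, zero_mul]
  rwa [this, sub_zero]

/-! ### Lower bounds for the `L_q` quasi-norm -/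

/-- Chebyshev's inequality. Positivity of the measure matters for `q = ∞`, where the power of the
volume is `1` even for a null set. -/
theorem mul_volume_rpow_le_lpQuasiNorm {d : ℕ} {q : ℝ≥0∞} (hq : 0 < q) {F : (Fin d → ℝ) → ℂ}
    {a : ℝ} (ha : 0 ≤ a) {S : Set (Fin d → ℝ)} (hS : MeasurableSet S)
    (hF : ∀ x ∈ S, a ≤ ‖F x‖) (hpos : volume (S ∩ unitCube d) ≠ 0) :
    ENNReal.ofReal a * volume (S ∩ unitCube d) ^ (1 / q.toReal) ≤ lpQuasiNorm F q := by
  have h1 : eLpNorm (S.indicator fun _ => a) q (volume.restrict (unitCube d)) =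
      ENNReal.ofReal a * volume (S ∩ unitCube d) ^ (1 / q.toReal) := by
    rw [eLpNorm_indicator_const' hS (by rwa [Measure.restrict_apply hS]) hq.ne',
      Measure.restrict_apply hS, Real.enorm_of_nonneg ha]
  rw [← h1]
  refine eLpNorm_mono fun x => ?_
  by_cases hx : x ∈ S
  · rw [Set.indicator_of_mem hx, Real.norm_of_nonneg ha]
    exact hF x hx
  · rw [Set.indicator_of_notMem hx, norm_zero]
    exact norm_nonneg _

theorem norm_tensorSum {d ℓ : ℕ} {p : ℝ≥0∞} {η C A : ℝ} {u : ℕ → ℝ → ℝ}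
    (hu : IsAtomFamily ℓ p η C u) (hA : 0 ≤ A) (K : Finset (Fin d → ℕ)) (x : Fin d → ℝ) :
    ‖tensorSum A K (fun k i => u (k i)) x‖ = A * ∑ k ∈ K, ∏ i, u (k i) (x i) := by
  rw [tensorSum, Complex.norm_real, ← Finset.mul_sum, Real.norm_of_nonneg]
  exact mul_nonneg hA (Finset.sum_nonneg fun k _ => Finset.prod_nonneg fun i _ => hu.nonneg _ _)

/-- The box on which the tensor product of tiles of level `k` nearest to the origin is `1`. -/
def plateau {d : ℕ} (k : Fin d → ℕ) : Set (Fin d → ℝ) :=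
  Set.univ.pi fun i => Set.Icc (11 / 16 * (2 ^ k i)⁻¹ : ℝ) (13 / 16 * (2 ^ k i)⁻¹)

theorem two_pow_inv_le_one (k : ℕ) : ((2 : ℝ) ^ k)⁻¹ ≤ 1 :=
  inv_le_one_of_one_le₀ (one_le_pow₀ (by norm_num))

theorem tile_eq_one {k : ℕ} {x : ℝ}
    (hx : x ∈ Set.Icc (11 / 16 * (2 ^ k)⁻¹ : ℝ) (13 / 16 * (2 ^ k)⁻¹)) : tile k x = 1 := by
  have h2 : (0 : ℝ) < 2 ^ k := by positivity
  have h2' : (0 : ℝ) < (2 ^ k)⁻¹ := by positivity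
  have h1 := two_pow_inv_le_one k
  rw [tile, Int.fract_eq_self.2 ⟨by linarith [hx.1], by linarith [hx.2]⟩]
  have hc : (2 : ℝ) ^ k * (2 ^ k)⁻¹ = 1 := mul_inv_cancel₀ h2.ne'
  refine bump_eq_one ⟨?_, ?_⟩
  · have := mul_le_mul_of_nonneg_left hx.1 h2.le
    linarith
  · have := mul_le_mul_of_nonneg_left hx.2 h2.le
    linarith

/-- In a coordinate where the levels differ, the finer interval ends at or below `13/32` of the
coarser scale, whereas the coarser one starts at `11/16`. -/
theorem disjoint_plateau {d : ℕ} {k k' : Fin d → ℕ} (h : k ≠ k') :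
    Disjoint (plateau k) (plateau k') := by
  have key : ∀ {a b : ℕ} {y : ℝ}, a < b →
      y ∈ Set.Icc (11 / 16 * (2 ^ a)⁻¹ : ℝ) (13 / 16 * (2 ^ a)⁻¹) →
      y ∈ Set.Icc (11 / 16 * (2 ^ b)⁻¹ : ℝ) (13 / 16 * (2 ^ b)⁻¹) → False := by
    intro a b y hab ha hb
    have h0 : (0 : ℝ) < (2 ^ a)⁻¹ := by positivity
    have : ((2 : ℝ) ^ b)⁻¹ ≤ (2 ^ a)⁻¹ / 2 := by
      rw [div_eq_mul_inv, ← mul_inv, ← pow_succ]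
      exact inv_anti₀ (by positivity) (pow_le_pow_right₀ (by norm_num) hab)
    linarith [ha.1, hb.2]
  obtain ⟨i, hi⟩ := Function.ne_iff.1 h
  refine Set.disjoint_left.2 fun x hx hx' => ?_
  rcases lt_or_gt_of_ne hi with h | h
  · exact key h (hx i (Set.mem_univ i)) (hx' i (Set.mem_univ i))
  · exact key h (hx' i (Set.mem_univ i)) (hx i (Set.mem_univ i))

theorem plateau_subset_unitCube {d : ℕ} (k : Fin d → ℕ) : plateau k ⊆ unitCube d := by
  refine Set.pi_mono fun i _ => Set.Icc_subset_Icc (by positivity) ?_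
  linarith [two_pow_inv_le_one (k i)]

theorem volume_plateau {d m : ℕ} {k : Fin d → ℕ} (hk : ∑ i, k i = m) :
    volume (plateau k) = ENNReal.ofReal ((1 / 8) ^ d * 2 ^ (-(m : ℝ))) := by
  rw [plateau, volume_pi_pi]
  simp only [Real.volume_Icc]
  rw [← ENNReal.ofReal_prod_of_nonneg]
  · congr 1
    have : ∀ i, (13 / 16 * (2 ^ k i)⁻¹ - 11 / 16 * (2 ^ k i)⁻¹ : ℝ) = 1 / 8 * (2 ^ k i)⁻¹ :=
      fun i => by ring
    simp only [this]
    rw [Finset.prod_mul_distrib, Finset.prod_const, Finset.card_univ, Fintype.card_fin,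
      Finset.prod_inv_distrib, Finset.prod_pow_eq_pow_sum, hk, Real.rpow_neg (by norm_num),
      Real.rpow_natCast]
  · intro i _
    have : (0 : ℝ) < (2 ^ k i)⁻¹ := by positivity
    linarith

theorem measurableSet_plateau {d : ℕ} (k : Fin d → ℕ) : MeasurableSet (plateau k) :=
  MeasurableSet.univ_pi fun _ => measurableSet_Icc

/-- The sum is at least `A` on the union of the disjoint plateaus, a set of volume `8^{-d} 2^{-m}
|K|`. -/
theorem exists_le_lpQuasiNorm_tile {d ℓ : ℕ} {p q : ℝ≥0∞} {η C : ℝ} (hq : 0 < q)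
    (hu : IsAtomFamily ℓ p η C tile) :
    ∃ b : ℝ, 0 < b ∧ ∀ (A : ℝ) (m : ℕ) (K : Finset (Fin d → ℕ)), 0 ≤ A → K.Nonempty →
      (∀ k ∈ K, ∑ i, k i = m) →
      ENNReal.ofReal (b * A * 2 ^ (-((q⁻¹).toReal * m)) * (K.card : ℝ) ^ (q⁻¹).toReal) ≤
        lpQuasiNorm (tensorSum A K fun k i => tile (k i)) q := by
  refine ⟨((1 / 8) ^ d) ^ (q⁻¹).toReal, by positivity, fun A m K hA hne hK => ?_⟩
  set S : Set (Fin d → ℝ) := ⋃ k ∈ K, plateau k with hS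
  have hSm : MeasurableSet S := Finset.measurableSet_biUnion _ fun k _ => measurableSet_plateau k
  have hsub : S ⊆ unitCube d := Set.iUnion₂_subset fun k _ => plateau_subset_unitCube k
  have hvol : volume (S ∩ unitCube d) =
      ENNReal.ofReal (K.card * ((1 / 8) ^ d * 2 ^ (-(m : ℝ)))) := by
    rw [Set.inter_eq_left.2 hsub, hS,
      measure_biUnion_finset (fun k _ k' _ h => disjoint_plateau h)
        fun k _ => measurableSet_plateau k,
      Finset.sum_congr rfl fun k hk => volume_plateau (hK k hk), Finset.sum_const, nsmul_eq_mul,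
      ENNReal.ofReal_mul (p := (K.card : ℝ)) (by positivity), ENNReal.ofReal_natCast]
  have hcard : (0 : ℝ) < K.card := by exact_mod_cast hne.card_pos
  have key := mul_volume_rpow_le_lpQuasiNorm hq hA hSm
    (F := tensorSum A K fun k i => tile (k i)) (fun x hx => ?_) ?_
  · refine le_trans (le_of_eq ?_) key
    have hqi : 1 / q.toReal = (q⁻¹).toReal := by rw [ENNReal.toReal_inv, one_div]
    rw [hvol, hqi,
      ENNReal.ofReal_rpow_of_nonneg (by positivity) ENNReal.toReal_nonneg, ← ENNReal.ofReal_mul hA,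
      Real.mul_rpow (by positivity) (by positivity), Real.mul_rpow (by positivity) (by positivity),
      ← Real.rpow_mul (by norm_num)]
    ring_nf
  · rw [norm_tensorSum hu hA]
    refine le_mul_of_one_le_right hA ?_
    obtain ⟨k, hk, hxk⟩ := Set.mem_iUnion₂.1 hx
    have : ∏ i, tile (k i) (x i) = 1 :=
      Finset.prod_eq_one fun i _ => tile_eq_one (hxk i (Set.mem_univ i))
    rw [← this]
    exact Finset.single_le_sum (f := fun k => ∏ i, tile (k i) (x i))
      (fun k _ => Finset.prod_nonneg fun i _ => hu.nonneg _ _) hk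
  · rw [hvol]
    exact (ENNReal.ofReal_pos.2 (by positivity)).ne'

theorem volume_unitCube (d : ℕ) : volume (unitCube d) = 1 := by
  rw [unitCube, volume_pi_pi]
  simp

theorem isCompact_unitCube (d : ℕ) : IsCompact (unitCube d) :=
  isCompact_univ_pi fun _ => isCompact_Icc

/-- A Paley–Zygmund argument: a function bounded by `N` with mean at least `N c` cannot stay below
half that mean outside a set of measure less than `c / 2`. -/
theorem le_volume_superlevel {d : ℕ} {N c : ℝ} (hN : 0 < N) {f : (Fin d → ℝ) → ℝ}
    (hf : Continuous f) (h1 : ∀ x, f x ≤ N)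
    (hI : N * c ≤ ∫ x in unitCube d, f x) :
    ENNReal.ofReal (c / 2) ≤ volume ({x | N * (c / 2) ≤ f x} ∩ unitCube d) := by
  set S := {x | N * (c / 2) ≤ f x} with hS
  have hSm : MeasurableSet S := (isClosed_le continuous_const hf).measurableSet
  set μ := (volume : Measure (Fin d → ℝ)).restrict (unitCube d) with hμ
  have : IsProbabilityMeasure μ := ⟨by rw [hμ, Measure.restrict_apply_univ, volume_unitCube]⟩
  have hint : Integrable f μ := hf.continuousOn.integrableOn_compact (isCompact_unitCube d)
  rcases le_or_gt c 0 with hc | hc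
  · rw [ENNReal.ofReal_of_nonpos (by linarith)]
    exact zero_le
  have hle : ∫ x, f x ∂μ ≤ ∫ x, (S.indicator (fun _ => N) x + N * (c / 2)) ∂μ := by
    refine integral_mono hint (((integrable_const N).indicator hSm).add (integrable_const _))
      fun x => ?_
    simp only
    by_cases hx : x ∈ S
    · rw [Set.indicator_of_mem hx]
      have := h1 x
      have : 0 < N * (c / 2) := by positivity
      linarith
    · rw [Set.indicator_of_notMem hx, zero_add]
      exact (not_le.1 hx).le
  rw [integral_add ((integrable_const N).indicator hSm) (integrable_const _),
    integral_indicator_const _ hSm] at hle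
  simp only [integral_const, probReal_univ, smul_eq_mul, one_mul] at hle
  have hfin : c / 2 ≤ μ.real S := by
    have : N * (c / 2) ≤ N * μ.real S := by linarith
    exact le_of_mul_le_mul_left this hN
  rw [← Measure.restrict_apply hSm]
  exact (ENNReal.ofReal_le_iff_le_toReal (measure_ne_top μ S)).2 hfin

theorem eighth_le_integral_wave (k : ℕ) : (1 / 8 : ℝ) ≤ ∫ x in Set.Icc (0 : ℝ) 1, wave k x := by
  have hc := continuous_tile 0
  have h0 : (1 / 8 : ℝ) ≤ ∫ x in (0 : ℝ)..1, tile 0 x := by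
    have h1 : ∫ x in (11 / 16 : ℝ)..(13 / 16), tile 0 x = 1 / 8 := by
      rw [intervalIntegral.integral_congr (g := fun _ => (1 : ℝ)) fun x hx => ?_]
      · norm_num
      · rw [Set.uIcc_of_le (by norm_num)] at hx
        exact tile_eq_one (by simpa using hx)
    rw [← h1]
    exact intervalIntegral.integral_mono_interval (by norm_num) (by norm_num) (by norm_num)
      (Filter.Eventually.of_forall fun x => bump.nonneg) (hc.intervalIntegrable _ _)
  refine h0.trans (le_of_eq ?_)
  rw [integral_Icc_eq_integral_Ioc, ← intervalIntegral.integral_of_le zero_le_one]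
  simp only [wave]
  rw [intervalIntegral.integral_comp_mul_left (fun x => tile 0 x) (by positivity : (2 : ℝ) ^ k ≠ 0)]
  have := (periodic_tile 0).intervalIntegral_add_zsmul_eq (2 ^ k) 0
    fun a b => hc.intervalIntegrable a b
  simp only [zero_add, zsmul_eq_mul, Int.cast_pow, Int.cast_ofNat, mul_one] at this
  rw [mul_zero, mul_one, this, smul_eq_mul, ← mul_assoc, inv_mul_cancel₀ (by positivity), one_mul]

/-- All summands have mean at least `8^{-d}` and values at most `1`, so their sum is comparable with
`|K|` on a set of fixed measure. That suffices for every `q`, including `q < 1`. The trivial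
exponents `0` and `1` stand for `ζ` and `β` in `exists_le_optimalRecovery`. -/
theorem exists_le_lpQuasiNorm_wave {d ℓ : ℕ} {p q : ℝ≥0∞} {η C : ℝ} (hq : 0 < q)
    (hu : IsAtomFamily ℓ p η C wave) :
    ∃ b : ℝ, 0 < b ∧ ∀ (A : ℝ) (m : ℕ) (K : Finset (Fin d → ℕ)), 0 ≤ A → K.Nonempty →
      (∀ k ∈ K, ∑ i, k i = m) →
      ENNReal.ofReal (b * A * 2 ^ (-((0 : ℝ) * m)) * (K.card : ℝ) ^ (1 : ℝ)) ≤
        lpQuasiNorm (tensorSum A K fun k i => wave (k i)) q := by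
  set c : ℝ := (1 / 8) ^ d with hc
  have hc0 : 0 < c := by positivity
  refine ⟨c / 2 * (c / 2) ^ (q⁻¹).toReal, by positivity, fun A m K hA hne hK => ?_⟩
  have hcard : (0 : ℝ) < K.card := by exact_mod_cast hne.card_pos
  set f : (Fin d → ℝ) → ℝ := fun x => ∑ k ∈ K, ∏ i, wave (k i) (x i) with hf
  have hpc : ∀ k : Fin d → ℕ, Continuous fun x : Fin d → ℝ => ∏ i, wave (k i) (x i) := fun k =>
    continuous_finsetProd _ fun i _ => (hu.continuous (k i)).comp (continuous_apply i)
  have hfc : Continuous f := continuous_finsetSum _ fun k _ => hpc k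
  have hf1 : ∀ x, f x ≤ K.card := fun x => by
    refine (Finset.sum_le_sum (g := fun _ => (1 : ℝ)) fun k _ => ?_).trans (by simp)
    exact Finset.prod_le_one (fun i _ => hu.nonneg _ _) fun i _ => hu.le_one _ _
  have hI : K.card * c ≤ ∫ x in unitCube d, f x := by
    simp only [hf]
    rw [integral_finsetSum _ fun k _ =>
      (hpc k).continuousOn.integrableOn_compact (isCompact_unitCube d), ← nsmul_eq_mul,
      ← Finset.sum_const]
    refine Finset.sum_le_sum fun k _ => ?_
    rw [unitCube, volume_pi, Measure.restrict_pi_pi,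
      integral_fintype_prod_eq_prod (fun i x => wave (k i) x)]
    have : c = ∏ _i : Fin d, (1 / 8 : ℝ) := by simp [hc]
    rw [this]
    exact Finset.prod_le_prod (fun _ _ => by norm_num) fun i _ => eighth_le_integral_wave (k i)
  have hvol := le_volume_superlevel hcard hfc hf1 hI
  have hSm : MeasurableSet {x | K.card * (c / 2) ≤ f x} :=
    (isClosed_le continuous_const hfc).measurableSet
  have key := mul_volume_rpow_le_lpQuasiNorm hq (a := A * (K.card * (c / 2))) (by positivity) hSm
    (F := tensorSum A K fun k i => wave (k i)) (fun x hx => ?_) ?_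
  · refine le_trans ?_ key
    refine le_trans (le_of_eq ?_)
      (mul_le_mul_right (ENNReal.rpow_le_rpow hvol (by positivity)) _)
    rw [one_div, ← ENNReal.toReal_inv,
      ENNReal.ofReal_rpow_of_nonneg (by positivity) ENNReal.toReal_nonneg,
      ← ENNReal.ofReal_mul (by positivity), zero_mul, neg_zero, Real.rpow_zero, Real.rpow_one]
    ring_nf
  · rw [norm_tensorSum hu hA]
    exact mul_le_mul_of_nonneg_left hx hA
  · exact ((ENNReal.ofReal_pos.2 (by positivity)).trans_le hvol).ne'

/-! ### Optimal levels and the rates -/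

/-- The level `m` is the largest with `2^m (m+1)^{d-1} ≤ Q n`. The cardinality bounds show that `m'`
satisfies this condition, so `m' ≤ m`. Maximality gives `log n ≤ d (m + 1)`, and the condition
itself then bounds `n⁻¹ log^{d-1} n` by a multiple of `2^{-m}`. -/
theorem exists_level {d : ℕ} (hd : 1 ≤ d) {n : ℕ} (hn : 1 ≤ n) {m' : ℕ}
    (hm' : (smolyakGrid d m').card ≤ n) :
    ∃ m, m' ≤ m ∧ Real.log n ^ (d - 1) ≤ (d : ℝ) ^ (d - 1) * ((m : ℝ) + 1) ^ (d - 1) ∧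
      (n : ℝ)⁻¹ * Real.log n ^ (d - 1) ≤
        ((d : ℝ) ^ (d - 1) * 2 ^ d * (d : ℝ) ^ (d - 1)) * 2 ^ (-(m : ℝ)) := by
  set Q : ℕ := d ^ (d - 1) * 2 ^ d with hQ
  set P : ℕ → Prop := fun m => 2 ^ m * (m + 1) ^ (d - 1) ≤ Q * n with hP
  have hQ1 : 1 ≤ Q := Nat.succ_le_of_lt (by positivity)
  have hlt : ∀ m, P m → m < Q * n := fun m hm =>
    (Nat.lt_two_pow_self).trans_le ((Nat.le_mul_of_pos_right _ (by positivity)).trans hm)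
  have hPm' : P m' := by
    calc 2 ^ m' * (m' + 1) ^ (d - 1) ≤ 2 ^ m' * (d ^ (d - 1) * (levels d m').card) :=
          Nat.mul_le_mul_left _ (pow_le_card_levels hd m')
      _ = d ^ (d - 1) * ((levels d m').card * 2 ^ m') := by ring
      _ ≤ d ^ (d - 1) * (2 ^ d * (smolyakGrid d m').card) :=
          Nat.mul_le_mul_left _ (levels_mul_two_pow_le_card d m')
      _ ≤ d ^ (d - 1) * (2 ^ d * n) := by gcongr
      _ = Q * n := by rw [hQ]; ring
  classical
  set m := Nat.findGreatest P (Q * n) with hm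
  have hmm' : m' ≤ m := Nat.le_findGreatest (hlt m' hPm').le hPm'
  have hPm : P m := Nat.findGreatest_spec (hlt m' hPm').le hPm'
  have hnP : ¬ P (m + 1) := fun h =>
    Nat.findGreatest_is_greatest (Nat.lt_succ_self m) (hlt _ h).le h
  have hn0 : (0 : ℝ) < n := by exact_mod_cast hn
  have hnle : n ≤ 2 ^ ((m + 1) * d) := by
    calc n ≤ Q * n := Nat.le_mul_of_pos_left _ hQ1
      _ ≤ 2 ^ (m + 1) * (m + 1 + 1) ^ (d - 1) := (not_le.1 hnP).le
      -- A crude bound is enough, since only the logarithm of `n` is needed.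
      _ ≤ 2 ^ (m + 1) * (2 ^ (m + 1)) ^ (d - 1) := by
          gcongr
          exact Nat.lt_two_pow_self
      _ = 2 ^ ((m + 1) * d) := by
          rw [← pow_succ', Nat.sub_add_cancel hd, ← pow_mul]
  have hlog0 : 0 ≤ Real.log n := Real.log_natCast_nonneg n
  have hlog : Real.log n ≤ d * (m + 1) := by
    calc Real.log n ≤ Real.log ((2 : ℝ) ^ ((m + 1) * d)) :=
          Real.log_le_log hn0 (by exact_mod_cast hnle)
      _ = ((m + 1 : ℕ) * d : ℝ) * Real.log 2 := by rw [Real.log_pow]; push_cast; ring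
      _ ≤ ((m + 1 : ℕ) * d : ℝ) * 1 := by
          gcongr
          linarith [Real.log_two_lt_d9]
      _ = d * (m + 1) := by push_cast; ring
  have h1 : Real.log n ^ (d - 1) ≤ (d : ℝ) ^ (d - 1) * ((m : ℝ) + 1) ^ (d - 1) := by
    rw [← mul_pow]
    exact pow_le_pow_left₀ hlog0 hlog _
  refine ⟨m, hmm', h1, ?_⟩
  have hPr : (2 : ℝ) ^ m * ((m : ℝ) + 1) ^ (d - 1) ≤ (d : ℝ) ^ (d - 1) * 2 ^ d * n := by
    have : ((2 ^ m * (m + 1) ^ (d - 1) : ℕ) : ℝ) ≤ ((Q * n : ℕ) : ℝ) := by exact_mod_cast hPm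
    rw [hQ] at this
    push_cast at this
    exact this
  have h2m : (0 : ℝ) < 2 ^ m := by positivity
  rw [Real.rpow_neg (by norm_num), Real.rpow_natCast, inv_mul_le_iff₀ hn0, ← div_eq_mul_inv,
    mul_div_assoc', le_div_iff₀ h2m]
  calc Real.log n ^ (d - 1) * 2 ^ m
      ≤ ((d : ℝ) ^ (d - 1) * ((m : ℝ) + 1) ^ (d - 1)) * 2 ^ m := by gcongr
    _ = (d : ℝ) ^ (d - 1) * (2 ^ m * ((m : ℝ) + 1) ^ (d - 1)) := by ring
    _ ≤ (d : ℝ) ^ (d - 1) * ((d : ℝ) ^ (d - 1) * 2 ^ d * n) := by gcongr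
    _ = _ := by ring

/-- All levels are used when `γ ≥ 0`; otherwise a single one is best, with value `1`. This choice is
what produces the positive part. -/
theorem exists_levels_card_rpow_ge {d : ℕ} (hd : 1 ≤ d) (m : ℕ) (γ : ℝ) :
    ∃ K : Finset (Fin d → ℕ), K.Nonempty ∧ (∀ k ∈ K, ∑ i, k i = m) ∧
      (((d : ℝ) ^ (d - 1))⁻¹ * ((m : ℝ) + 1) ^ (d - 1)) ^ max γ 0 ≤ (K.card : ℝ) ^ γ := by
  have hcard := pow_le_card_levels hd m
  have hd0 : (0 : ℝ) < d := by exact_mod_cast hd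
  have hne : (levels d m).Nonempty := by
    rw [← Finset.card_pos]
    by_contra! h0
    have : 0 < (m + 1) ^ (d - 1) := by positivity
    rw [Nat.le_zero.1 h0, mul_zero] at hcard
    omega
  rcases le_total 0 γ with hγ | hγ
  · refine ⟨levels d m, hne, fun k hk => mem_levels.1 hk, ?_⟩
    rw [max_eq_left hγ]
    refine Real.rpow_le_rpow (by positivity) ?_ hγ
    rw [inv_mul_le_iff₀ (by positivity)]
    exact_mod_cast hcard
  · obtain ⟨k, hk⟩ := hne
    refine ⟨{k}, Finset.singleton_nonempty k, fun k' hk' => ?_, ?_⟩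
    · rw [Finset.mem_singleton.1 hk']
      exact mem_levels.1 hk
    · rw [max_eq_right hγ]
      simp

/-- The argument common to both rates: `η` is the `L_p` decay of the atoms, while `ζ` and `β`
describe the lower bound in `L_q`. -/
theorem exists_le_optimalRecovery {d ℓ : ℕ} (hd : 1 ≤ d) {p q θ : ℝ≥0∞} {α η C ζ β : ℝ}
    {u : ℕ → ℝ → ℝ} (hp : 0 < p) (hθ : 0 < θ) (hu : IsAtomFamily ℓ p η C u) (hC : 1 ≤ C)
    (hα : 0 < α) (hαℓ : α < ℓ) (hζ : 0 ≤ α - η + ζ) (G : Domain)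
    (hlow : ∃ b : ℝ, 0 < b ∧ ∀ (A : ℝ) (m : ℕ) (K : Finset (Fin d → ℕ)), 0 ≤ A → K.Nonempty →
      (∀ k ∈ K, ∑ i, k i = m) →
      ENNReal.ofReal (b * A * 2 ^ (-(ζ * m)) * (K.card : ℝ) ^ β) ≤
        lpQuasiNorm (tensorSum A K fun k i => u (k i)) q) :
    ∃ c : ℝ, 0 < c ∧ ∀ n : ℕ, 1 ≤ n →
      ENNReal.ofReal (c * (((n : ℝ)⁻¹ * Real.log n ^ (d - 1)) ^ (α - η + ζ) *
          (Real.log n ^ (d - 1)) ^ (max (β - (θ⁻¹).toReal) 0))) ≤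
        optimalRecovery n (unitBall G d ℓ α p θ) q := by
  obtain ⟨D, hD, hup⟩ := exists_besovNorm_tensorSum_le (d := d) hp hθ hu hC hα hαℓ G
  obtain ⟨b, hb, hlow⟩ := hlow
  have hd0 : (0 : ℝ) < d := by exact_mod_cast hd
  set γ := max (β - (θ⁻¹).toReal) 0 with hγ
  have hγ0 : 0 ≤ γ := le_max_right _ _
  set E : ℝ := (d : ℝ) ^ (d - 1) with hE
  have hE0 : 0 < E := by positivity
  refine ⟨b / D * (E * 2 ^ d * E) ^ (-(α - η + ζ)) * (E * E) ^ (-γ), by positivity,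
    fun n hn => le_optimalRecovery fun m' hm' => ?_⟩
  obtain ⟨m, hmm', hlog, hrate⟩ := exists_level hd hn hm'
  obtain ⟨K, hne, hK, hcard⟩ := exists_levels_card_rpow_ge hd m (β - (θ⁻¹).toReal)
  rw [← hE] at hlog hrate hcard
  have hc0 : (0 : ℝ) < K.card := by exact_mod_cast hne.card_pos
  -- The amplitude that makes the upper bound for the Besov norm exactly `1`.
  set A : ℝ := (D * 2 ^ ((α - η) * m) * (K.card : ℝ) ^ (θ⁻¹).toReal)⁻¹ with hA
  have hA0 : 0 < A := by positivity
  refine ⟨tensorSum A K fun k i => u (k i), ⟨isContinuousOn_tensorSum hu K G, ?_⟩,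
    fun x hx => tensorSum_eq_zero hd hu K hK hmm' hx,
    le_trans (ENNReal.ofReal_le_ofReal ?_) (hlow A m K hA0.le hne hK)⟩
  · refine (hup A m K hA0.le hK).trans (le_of_eq ?_)
    rw [ENNReal.ofReal_eq_one, hA]
    field_simp
  · have hval : b * A * 2 ^ (-(ζ * m)) * (K.card : ℝ) ^ β =
        b / D * 2 ^ (-((α - η + ζ) * m)) * (K.card : ℝ) ^ (β - (θ⁻¹).toReal) := by
      have : (2 : ℝ) ^ (-((α - η + ζ) * m)) = (2 ^ ((α - η) * m))⁻¹ * 2 ^ (-(ζ * m)) := by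
        rw [← Real.rpow_neg (by norm_num), ← Real.rpow_add (by norm_num)]
        ring_nf
      rw [this, Real.rpow_sub hc0, hA, mul_inv, mul_inv]
      field_simp
    have hlog0 : 0 ≤ Real.log n ^ (d - 1) := pow_nonneg (Real.log_natCast_nonneg n) _
    have hr1 : ((n : ℝ)⁻¹ * Real.log n ^ (d - 1)) ^ (α - η + ζ) ≤
        (E * 2 ^ d * E) ^ (α - η + ζ) * 2 ^ (-((α - η + ζ) * m)) := by
      refine (Real.rpow_le_rpow (by positivity) hrate hζ).trans (le_of_eq ?_)
      rw [Real.mul_rpow (by positivity) (by positivity), ← Real.rpow_mul (by norm_num)]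
      ring_nf
    have hr2 : (Real.log n ^ (d - 1)) ^ γ ≤ (E * E) ^ γ * (K.card : ℝ) ^ (β - (θ⁻¹).toReal) := by
      refine le_trans ?_ (mul_le_mul_of_nonneg_left hcard (by positivity))
      rw [← Real.mul_rpow (by positivity) (by positivity)]
      refine Real.rpow_le_rpow hlog0 (hlog.trans (le_of_eq ?_)) hγ0
      field_simp
    rw [hval]
    calc b / D * (E * 2 ^ d * E) ^ (-(α - η + ζ)) * (E * E) ^ (-γ) *
          (((n : ℝ)⁻¹ * Real.log n ^ (d - 1)) ^ (α - η + ζ) * (Real.log n ^ (d - 1)) ^ γ)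
        ≤ b / D * (E * 2 ^ d * E) ^ (-(α - η + ζ)) * (E * E) ^ (-γ) *
          (((E * 2 ^ d * E) ^ (α - η + ζ) * 2 ^ (-((α - η + ζ) * m))) *
            ((E * E) ^ γ * (K.card : ℝ) ^ (β - (θ⁻¹).toReal))) := by
          gcongr
      _ = _ := by
          rw [Real.rpow_neg (by positivity), Real.rpow_neg (by positivity : 0 ≤ E * E)]
          have e1 : (E * 2 ^ d * E) ^ (α - η + ζ) ≠ 0 := by positivity
          have e2 : (E * E) ^ γ ≠ 0 := by positivity
          field_simp

end SmolyakSampling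

end

theorem theorem5p2 (G : SmolyakSampling.Domain) (d : ℕ) (hd : 1 ≤ d) (p q θ : ℝ≥0∞)
    (hp : 0 < p) (hq : 0 < q) (hθ : 0 < θ) (α : ℝ) (hα : (p⁻¹).toReal < α)
    (ℓ : ℕ) (hℓ : α < ℓ) :
    (q ≤ p → ∃ c : ℝ, 0 < c ∧ ∀ n : ℕ, 1 ≤ n →
      ENNReal.ofReal (c * (((n : ℝ)⁻¹ * Real.log n ^ (d - 1)) ^ α *
          (Real.log n ^ (d - 1)) ^ (max (1 - (θ⁻¹).toReal) 0))) ≤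
        SmolyakSampling.optimalRecovery n (SmolyakSampling.unitBall G d ℓ α p θ) q) ∧
    (p < q → ∃ c : ℝ, 0 < c ∧ ∀ n : ℕ, 1 ≤ n →
      ENNReal.ofReal (c * (((n : ℝ)⁻¹ * Real.log n ^ (d - 1)) ^
            (α - (p⁻¹).toReal + (q⁻¹).toReal) *
          (Real.log n ^ (d - 1)) ^ (max ((q⁻¹).toReal - (θ⁻¹).toReal) 0))) ≤
        SmolyakSampling.optimalRecovery n (SmolyakSampling.unitBall G d ℓ α p θ) q) := by
  have hα0 : 0 < α := ENNReal.toReal_nonneg.trans_lt hα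
  constructor
  · intro _
    -- Spread-out atoms: `η = ζ = 0` and `β = 1`.
    obtain ⟨C, hC, hu⟩ := SmolyakSampling.exists_isAtomFamily_wave ℓ p
    have := SmolyakSampling.exists_le_optimalRecovery hd hp hθ hu hC hα0 hℓ (by linarith) G
      (SmolyakSampling.exists_le_lpQuasiNorm_wave hq hu)
    simpa using this
  · intro _
    -- Concentrated atoms: `η = 1/p` and `ζ = β = 1/q`; the rate `α - 1/p + 1/q` is nonnegative
    -- since `α > 1/p`.
    obtain ⟨C, hC, hu⟩ := SmolyakSampling.exists_isAtomFamily_tile ℓ p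
    have hq0 : 0 ≤ (q⁻¹).toReal := ENNReal.toReal_nonneg
    exact SmolyakSampling.exists_le_optimalRecovery hd hp hθ hu hC hα0 hℓ (by linarith) G
      (SmolyakSampling.exists_le_lpQuasiNorm_tile hq hu)
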